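/- Let $\mathcal G=(V,E)$ be an infinite, connected, locally finite graph without loops, with conductances $W_{i,j}=W_{j,i}>0$ on the edges. Let $(\beta_i)_{i\in V}$ be a family of (a.s.) positive random variables with law $\nu_V^W$, i.e. such that for every finite $U\subset V$ and every $\lambda\in\mathbb R_+^U$ $$\mathbb E\Big(e^{-\sum_{i\in U}\lambda_i\beta_i}\Big)=e^{-\sum_{\{i,j\}\in E,\ i,j\in U}W_{i,j}\left(\sqrt{(1+\lambda_i)(1+\lambda_j)}-1\right)-\sum_{\{i,j\}\in E,\ i\in U,\ j\notin U}W_{i,j}\left(\sqrt{1+\lambda_i}-1\right)}\prod_{i\in U}\frac1{\sqrt{1+\lambda_i}} .$$ Let $(V_n)_{n\ge 0}$ be an increasing sequence of finite subsets of $V$ with $\bigcup_n V_n=V$, and let $\mathcal F_n=\sigma(\beta_i,\ i\in V_n)$. For a path $\sigma=(\sigma_0,\dots,\sigma_m)$ in $\mathcal G$ put $W_\sigma=\prod_{k=0}^{m-1}W_{\sigma_k,\sigma_{k+1}}$, $(2\beta)_\sigma=\prod_{k=0}^{m}2\beta_{\sigma_k}$ and $(2\beta)^-_\sigma=\prod_{k=0}^{m-1}2\beta_{\sigma_k}$.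 Define $\hat G^{(n)}(i,j)=\sum_\sigma W_\sigma/(2\beta)_\sigma$, the sum over all paths in $V_n$ from $i$ to $j$, if $i,j\in V_n$, and $\hat G^{(n)}(i,j)=0$ otherwise. Define $\psi^{(n)}(i)=\sum_\sigma W_\sigma/(2\beta)^-_\sigma$, the sum over all paths $\sigma$ from $i$ to a point outside $V_n$ with $\sigma_0,\dots,\sigma_{m-1}\in V_n$, if $i\in V_n$, and $\psi^{(n)}(i)=1$ if $i\notin V_n$. Then all these path sums converge a.s., and the following hold. (1) For all $n$ and $i\in V$, $\psi^{(n)}(i)$ has finite moments of all orders, and for every $i\in V$ the sequence $(\psi^{(n)}(i))_{n\ge0}$ is an $(\mathcal F_n)$-martingale. (2) For all $n$ and $i,j\in V$, $\hat G^{(n)}(i,j)$ is integrable, and a.s. $$\mathbb E\big(\psi^{(n+1)}(i)\psi^{(n+1)}(j)-\psi^{(n)}(i)\psi^{(n)}(j)\,\big|\,\mathcal F_n\big)=\mathbb E\big(\hat G^{(n+1)}(i,j)-\hat G^{(n)}(i,j)\,\big|\,\mathcal F_n\big).$$ (3) For every finitely supported $\lambda:V\to[0,\infty)$, the sequence $e^{-\langle\lambda,\psi^{(n)}\rangle-\frac12\langle\lambda,\hat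 G^{(n)}\lambda\rangle}$, $n\ge0$, is an $(\mathcal F_n)$-martingale, where $\langle\lambda,\psi^{(n)}\rangle=\sum_i\lambda_i\psi^{(n)}(i)$ and $\langle\lambda,\hat G^{(n)}\lambda\rangle=\sum_{i,j}\lambda_i\hat G^{(n)}(i,j)\lambda_j$. -/

import Mathlib

open MeasureTheory ProbabilityTheory
open scoped ENNReal

noncomputable section

namespace VRJP

section Field

variable {V : Type*} (G : SimpleGraph V) (W : V → V → ℝ)

open Classical in
/-- The Laplace transform, at `(lam i)_{i ∈ U}`, of the field `β` restricted to the finite set `U`.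
In the first sum every edge inside `U` occurs as two ordered pairs, whence the factor `1 / 2`; the
second sum runs over the edges leaving `U`. -/
def betaLaplace [G.LocallyFinite] (U : Finset V) (lam : V → ℝ) : ℝ :=
  Real.exp
      (-((1 / 2 : ℝ) * ∑ i ∈ U, ∑ j ∈ U with G.Adj i j,
            W i j * (Real.sqrt ((1 + lam i) * (1 + lam j)) - 1))
        - ∑ i ∈ U, ∑ j ∈ G.neighborFinset i with j ∉ U, W i j * (Real.sqrt (1 + lam i) - 1))
    * (1 / ∏ i ∈ U, Real.sqrt (1 + lam i))

/-- `β` is a family of (almost surely) positive random variables with law `ν_V^W`, the law on `ℝ^V`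
given by the Laplace transforms of its finite-dimensional marginals. -/
structure IsBetaField [G.LocallyFinite] {Ω : Type*} [MeasurableSpace Ω]
    (P : Measure Ω) (β : V → Ω → ℝ) : Prop where
  measurable : ∀ i, Measurable (β i)
  pos : ∀ i, ∀ᵐ ω ∂P, 0 < β i ω
  laplace : ∀ (U : Finset V) (lam : V → ℝ), (∀ i ∈ U, 0 ≤ lam i) →
    ∫ ω, Real.exp (-∑ i ∈ U, lam i * β i ω) ∂P = betaLaplace G W U lam

end Field

section Paths

variable {V : Type*} {G : SimpleGraph V}

/-- `W_σ`, the product of the conductances along the steps of the path `σ`. -/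
def pathConductance (W : V → V → ℝ) {i j : V} (σ : G.Walk i j) : ℝ :=
  (σ.darts.map fun d => W d.fst d.snd).prod

/-- `(2β)_σ`, the product of `2 β` over all the points of the path, the last one included. -/
def pathPotential (b : V → ℝ) {i j : V} (σ : G.Walk i j) : ℝ :=
  (σ.support.map fun v => 2 * b v).prod

/-- `(2β)^-_σ`, the product of `2 β` over all the points of the path but the last one. -/
def pathPotentialMinus (b : V → ℝ) {i j : V} (σ : G.Walk i j) : ℝ :=
  (σ.support.dropLast.map fun v => 2 * b v).prod

variable (G)

/-- The paths from `i` to `j` in the set `U`. -/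
abbrev PathsIn (U : Finset V) (i j : V) : Type _ :=
  {σ : G.Walk i j // ∀ v ∈ σ.support, v ∈ U}

/-- The paths from `i` to some point outside `U`, all of whose points but the last are in `U`. -/
abbrev ExitPaths (U : Finset V) (i : V) : Type _ :=
  {σ : Σ j : V, G.Walk i j // σ.1 ∉ U ∧ ∀ v ∈ σ.2.support.dropLast, v ∈ U}

variable (W : V → V → ℝ)

/-- The term `W_σ / (2β)_σ` of the path sum for the Green function. -/
def greenTerm (U : Finset V) (b : V → ℝ) (i j : V) (σ : PathsIn G U i j) : ℝ :=
  pathConductance W σ.1 / pathPotential b σ.1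

/-- The term `W_σ / (2β)^-_σ` of the path sum for `ψ`. -/
def psiTerm (U : Finset V) (b : V → ℝ) (i : V) (σ : ExitPaths G U i) : ℝ :=
  pathConductance W σ.1.2 / pathPotentialMinus b σ.1.2

open Classical in
/-- `Ĝ^U(i, j)` for the potential `b`. -/
def greenHat (U : Finset V) (b : V → ℝ) (i j : V) : ℝ :=
  if i ∈ U ∧ j ∈ U then ∑' σ : PathsIn G U i j, greenTerm G W U b i j σ else 0

open Classical in
/-- `ψ^U(i)` for the potential `b`. -/
def psi (U : Finset V) (b : V → ℝ) (i : V) : ℝ :=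
  if i ∈ U then ∑' σ : ExitPaths G U i, psiTerm G W U b i σ else 1

/-- `⟨lam, ψ^U⟩ + ½ ⟨lam, Ĝ^U lam⟩` for a finitely supported `lam`. -/
def expoForm (U : Finset V) (b : V → ℝ) (lam : V →₀ ℝ) : ℝ :=
  ∑ i ∈ lam.support, lam i * psi G W U b i
    + (1 / 2 : ℝ) * ∑ i ∈ lam.support, ∑ j ∈ lam.support, lam i * greenHat G W U b i j * lam j

end Paths

/-- The filtration `F_n = σ(β_i, i ∈ V_n)`. -/
def betaFiltration {V Ω : Type*} [mΩ : MeasurableSpace Ω] (β : V → Ω → ℝ)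
    (hβ : ∀ i, Measurable (β i)) (Vn : ℕ → Finset V) (hmono : Monotone Vn) :
    Filtration ℕ mΩ where
  seq n := ⨆ i ∈ Vn n, MeasurableSpace.comap (β i) inferInstance
  mono' _ _ h := biSup_mono fun _ hi => hmono h hi
  le' _ := iSup₂_le fun i _ => (hβ i).comap_le

end VRJP

end

/-! Everything rests on one Laplace transform. For finite `U` and μ, λ ≥ 0, with sums over `U`, E
exp(-⟨μ,β⟩ - ⟨λ,ψ⟩ - ½⟨λ,Ĝλ⟩) = exp(-∑ λ_i √(1+μ_i)) · E exp(-⟨μ,β⟩); this is `HasGreenLaplace`. If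
μ is supported in `U' ⊆ U`, the right side, completed by the deterministic contribution of λ outside
`U`, does not depend on `U`. Uniqueness of Laplace transforms then gives the exponential functionals
of `U` and `U'` the same integral on every event of σ(β_i, i ∈ U'), which is (3)
(`IsBetaField.setIntegral_expoForm_eq`). Replacing λ by ελ and comparing the coefficients of ε and
ε² at 0 shows that ψ and ψψ - Ĝ are martingales, whence (1) and (2).

The transform is proved by adding points to `U` one at a time. The path sum Ĝ is the inverse of 2β -
W on `U`. Adding `k` changes it by a rank one term with denominator the Schur complement y = 2β_k -
⟨W_k, Ĝ W_k⟩. Let x = √y have, given β on `U`, the density √(2/π) exp(-½(x - a/x)²) for the right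
drift a. Integrating x out turns the transform on `U ∪ {k}` at λ into the one on `U` at λ_i +
(√(1+μ_k) - 1) W_{k,i}, which is exactly the recursion of the prescribed Laplace transform
(`lintegral_extendedPotential`, `betaLaplace_cons`). At λ = 0 this identifies the law of β on `U ∪
{k}`. Hence y > 0 almost surely, the new Green function exists, and general λ follows.

The expansion needs moments. Since V is infinite, some point o lies outside `U`, and y > 0 at o
bounds Ĝ near o in terms of β_o. The Green equation carries the bound along edges at the cost of a
factor 2β/W per step, and β has exponential moments. -/

noncomputable section

namespace VRJP

/-! ### Walk sums in `ℝ≥0∞` and the first step equation -/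

section WalkSum

variable {V : Type*} {G : SimpleGraph V}

/-- Multiplicative weight of a walk: a factor `a` for each step and a factor `c` for the last
point. -/
def walkWeight (c : V → ℝ≥0∞) (a : V → V → ℝ≥0∞) : ∀ {i j : V}, G.Walk i j → ℝ≥0∞
  | i, _, .nil => c i
  | i, _, .cons (v := l) _ p => a i l * walkWeight c a p

variable (G) in
/-- The total weight of all walks starting from `i`. -/
def walkSum (c : V → ℝ≥0∞) (a : V → V → ℝ≥0∞) (i : V) : ℝ≥0∞ :=
  ∑' σ : Σ j, G.Walk i j, walkWeight c a σ.2

variable (G) in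
/-- A walk from `i` is either trivial or a first step followed by a walk. -/
def walkFirstStep (i : V) :
    (Σ j, G.Walk i j) ≃ Unit ⊕ (Σ l : G.neighborSet i, Σ j, G.Walk l.1 j) where
  toFun σ := match σ with
    | ⟨_, .nil⟩ => .inl ()
    | ⟨j, .cons (v := l) h p⟩ => .inr ⟨⟨l, h⟩, ⟨j, p⟩⟩
  invFun s := match s with
    | .inl _ => ⟨i, .nil⟩
    | .inr ⟨l, ⟨j, p⟩⟩ => ⟨j, .cons l.2 p⟩
  left_inv := by rintro ⟨j, _ | _⟩ <;> rfl
  right_inv := by rintro (_ | _) <;> rfl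

lemma tsum_walks_eq [G.LocallyFinite] (i : V) (f : (Σ j, G.Walk i j) → ℝ≥0∞) :
    ∑' σ, f σ = f ⟨i, .nil⟩
      + ∑ l : G.neighborSet i, ∑' σ : Σ j, G.Walk l.1 j, f ⟨σ.1, .cons ((G.mem_neighborSet _ _).1 l.2) σ.2⟩ := by
  rw [← (walkFirstStep G i).symm.tsum_eq, Summable.tsum_sum ENNReal.summable ENNReal.summable]
  congr 1
  · simp [walkFirstStep]
  · rw [ENNReal.tsum_sigma', tsum_fintype]
    rfl

lemma sum_neighborSet [G.LocallyFinite] {M : Type*} [AddCommMonoid M] (i : V) (f : V → M) :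
    ∑ l : G.neighborSet i, f l.1 = ∑ l ∈ G.neighborFinset i, f l := by
  rw [SimpleGraph.neighborFinset_def]
  exact (Finset.sum_subtype _ (by simp) f).symm

lemma walkSum_eq [G.LocallyFinite] (c : V → ℝ≥0∞) (a : V → V → ℝ≥0∞) (i : V) :
    walkSum G c a i = c i + ∑ l ∈ G.neighborFinset i, a i l * walkSum G c a l := by
  rw [walkSum, tsum_walks_eq, ← sum_neighborSet]
  simp only [walkWeight, ENNReal.tsum_mul_left]
  rfl

/-- Induction on the length bound: deleting the first step of a walk of length at most `N + 1`
leaves one of length at most `N`, and the supersolution inequality absorbs that step. -/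
lemma truncated_walkSum_le [G.LocallyFinite] {c : V → ℝ≥0∞} {a : V → V → ℝ≥0∞} {x : V → ℝ≥0∞}
    (hx : ∀ i, c i + ∑ l ∈ G.neighborFinset i, a i l * x l ≤ x i) (N : ℕ) (i : V) :
    ∑' σ : Σ j, G.Walk i j, (if σ.2.length ≤ N then walkWeight c a σ.2 else 0) ≤ x i := by
  induction N generalizing i with
  | zero =>
    rw [tsum_walks_eq]
    refine le_trans ?_ (le_trans le_self_add (hx i))
    simp [walkWeight]
  | succ N ih =>
    rw [tsum_walks_eq]
    refine le_trans ?_ (hx i)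
    rw [← sum_neighborSet]
    simp only [walkWeight, SimpleGraph.Walk.length_nil, zero_le, if_true,
      SimpleGraph.Walk.length_cons, add_le_add_iff_right]
    gcongr with l _
    refine le_trans (le_of_eq ?_) (mul_le_mul_right (ih l.1) (a i l))
    rw [← ENNReal.tsum_mul_left]
    simp

/-- The total weight of walks is the least supersolution of the first step equation. -/
lemma walkSum_le [G.LocallyFinite] {c : V → ℝ≥0∞} {a : V → V → ℝ≥0∞} {x : V → ℝ≥0∞}
    (hx : ∀ i, c i + ∑ l ∈ G.neighborFinset i, a i l * x l ≤ x i) (i : V) :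
    walkSum G c a i ≤ x i := by
  rw [walkSum, ENNReal.tsum_eq_iSup_sum]
  refine iSup_le fun s => le_trans ?_ (truncated_walkSum_le hx (s.sup fun σ => σ.2.length) i)
  refine le_trans (Finset.sum_le_sum fun σ hσ => ?_) (ENNReal.sum_le_tsum s)
  rw [if_pos (Finset.le_sup (f := fun σ : Σ j, G.Walk i j => σ.2.length) hσ)]

end WalkSum

/-! ### The path sums as sums over all walks with killing outside `U` -/

section Terms

variable {V : Type*} {G : SimpleGraph V} {W : V → V → ℝ} {U : Finset V} {b : V → ℝ}

variable (W U b) in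
open Classical in
/-- The weight of a step of a walk killed when it leaves `U`. -/
def stepWeight (i l : V) : ℝ := if i ∈ U then W i l / (2 * b i) else 0

variable (U b) in
open Classical in
/-- The terminal weight for the Green function. -/
def greenEnd (j i : V) : ℝ := if i = j ∧ i ∈ U then 1 / (2 * b i) else 0

variable (U) in
open Classical in
/-- The terminal weight for `ψ`. -/
def psiEnd (i : V) : ℝ := if i ∈ U then 0 else 1

lemma pathPotential_pos (hb : ∀ v ∈ U, 0 < b v) {i j : V} (σ : G.Walk i j)
    (hσ : ∀ v ∈ σ.support, v ∈ U) : 0 < pathPotential b σ := by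
  refine List.prod_pos fun x hx => ?_
  obtain ⟨v, hv, rfl⟩ := List.mem_map.1 hx
  have := hb v (hσ v hv)
  positivity

lemma pathPotentialMinus_pos (hb : ∀ v ∈ U, 0 < b v) {i j : V} (σ : G.Walk i j)
    (hσ : ∀ v ∈ σ.support.dropLast, v ∈ U) : 0 < pathPotentialMinus b σ := by
  refine List.prod_pos fun x hx => ?_
  obtain ⟨v, hv, rfl⟩ := List.mem_map.1 hx
  have := hb v (hσ v hv)
  positivity

lemma pathConductance_nonneg (hW : ∀ i j, G.Adj i j → 0 < W i j) {i j : V} (σ : G.Walk i j) :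
    0 ≤ pathConductance W σ := by
  refine List.prod_nonneg fun x hx => ?_
  obtain ⟨d, -, rfl⟩ := List.mem_map.1 hx
  exact (hW _ _ d.adj).le

lemma pathConductance_cons {i l j : V} (h : G.Adj i l) (p : G.Walk l j) :
    pathConductance W (.cons h p) = W i l * pathConductance W p := by
  simp [pathConductance]

lemma pathPotential_cons {i l j : V} (h : G.Adj i l) (p : G.Walk l j) :
    pathPotential b (.cons h p) = 2 * b i * pathPotential b p := by
  simp [pathPotential]

lemma support_cons_dropLast {i l j : V} (h : G.Adj i l) (p : G.Walk l j) :
    (SimpleGraph.Walk.cons h p).support.dropLast = i :: p.support.dropLast := by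
  rw [SimpleGraph.Walk.support_cons, List.dropLast_cons_of_ne_nil p.support_ne_nil]

lemma pathPotentialMinus_cons {i l j : V} (h : G.Adj i l) (p : G.Walk l j) :
    pathPotentialMinus b (.cons h p) = 2 * b i * pathPotentialMinus b p := by
  rw [pathPotentialMinus, support_cons_dropLast]
  simp [pathPotentialMinus]

-- The step weights vanish at points outside `U` and the terminal weight tests the last point, so
-- walks that are not admissible contribute 0. A sum over a subtype of paths thus becomes a sum over
-- all walks, to which the first step equation applies.
open Classical in
lemma walkWeight_green (hW : ∀ i j, G.Adj i j → 0 < W i j) (hb : ∀ v ∈ U, 0 < b v) {k i j : V}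
    (σ : G.Walk i j) :
    walkWeight (fun i => ENNReal.ofReal (greenEnd U b k i))
        (fun i l => ENNReal.ofReal (stepWeight W U b i l)) σ
      = if j = k ∧ ∀ v ∈ σ.support, v ∈ U
        then ENNReal.ofReal (pathConductance W σ / pathPotential b σ) else 0 := by
  induction σ with
  | nil =>
    simp only [walkWeight, greenEnd, pathConductance, pathPotential, SimpleGraph.Walk.support_nil,
      List.mem_singleton, forall_eq]
    split_ifs <;> simp
  | @cons i l j h p ih =>
    rw [walkWeight, ih]
    simp only [pathConductance_cons, pathPotential_cons,
      SimpleGraph.Walk.support_cons, List.forall_mem_cons, stepWeight]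
    by_cases hi : i ∈ U <;> by_cases hp : j = k ∧ ∀ v ∈ p.support, v ∈ U
    · have h1 := hb i hi
      have h2 := hW _ _ h
      rw [if_pos hi, if_pos hp, if_pos ⟨hp.1, hi, hp.2⟩, ← ENNReal.ofReal_mul (by positivity),
        div_mul_div_comm]
    · rw [if_neg hp, mul_zero, if_neg fun h' => hp ⟨h'.1, h'.2.2⟩]
    · rw [if_neg hi, ENNReal.ofReal_zero, zero_mul, if_neg fun h' => hi h'.2.1]
    · rw [if_neg hp, mul_zero, if_neg fun h' => hp ⟨h'.1, h'.2.2⟩]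

open Classical in
lemma walkWeight_psi (hW : ∀ i j, G.Adj i j → 0 < W i j) (hb : ∀ v ∈ U, 0 < b v) {i j : V}
    (σ : G.Walk i j) :
    walkWeight (fun i => ENNReal.ofReal (psiEnd U i))
        (fun i l => ENNReal.ofReal (stepWeight W U b i l)) σ
      = if j ∉ U ∧ ∀ v ∈ σ.support.dropLast, v ∈ U
        then ENNReal.ofReal (pathConductance W σ / pathPotentialMinus b σ) else 0 := by
  induction σ with
  | nil =>
    simp only [walkWeight, psiEnd, pathConductance, pathPotentialMinus,
      SimpleGraph.Walk.support_nil]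
    split_ifs <;> simp_all
  | @cons i l j h p ih =>
    rw [walkWeight, ih]
    simp only [pathConductance_cons, pathPotentialMinus_cons,
      support_cons_dropLast, List.forall_mem_cons, stepWeight]
    by_cases hi : i ∈ U <;> by_cases hp : j ∉ U ∧ ∀ v ∈ p.support.dropLast, v ∈ U
    · have h1 := hb i hi
      have h2 := hW _ _ h
      rw [if_pos hi, if_pos hp, if_pos ⟨hp.1, hi, hp.2⟩, ← ENNReal.ofReal_mul (by positivity),
        div_mul_div_comm]
    · rw [if_neg hp, mul_zero, if_neg fun h' => hp ⟨h'.1, h'.2.2⟩]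
    · rw [if_neg hi, ENNReal.ofReal_zero, zero_mul, if_neg fun h' => hi h'.2.1]
    · rw [if_neg hp, mul_zero, if_neg fun h' => hp ⟨h'.1, h'.2.2⟩]

lemma tsum_greenTerm (hW : ∀ i j, G.Adj i j → 0 < W i j) (hb : ∀ v ∈ U, 0 < b v) (i j : V) :
    ∑' σ : PathsIn G U i j, ENNReal.ofReal (greenTerm G W U b i j σ)
      = walkSum G (fun i => ENNReal.ofReal (greenEnd U b j i))
          (fun i l => ENNReal.ofReal (stepWeight W U b i l)) i := by
  classical
  rw [walkSum, ENNReal.tsum_sigma, tsum_eq_single j]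
  · refine (tsum_subtype {σ : G.Walk i j | ∀ v ∈ σ.support, v ∈ U}
      (fun σ => ENNReal.ofReal (pathConductance W σ / pathPotential b σ))).trans ?_
    refine tsum_congr fun σ => ?_
    rw [walkWeight_green hW hb]
    simp [Set.indicator_apply]
  · intro k hk
    rw [ENNReal.tsum_eq_zero]
    intro σ
    rw [walkWeight_green hW hb, if_neg (by tauto)]

lemma tsum_psiTerm (hW : ∀ i j, G.Adj i j → 0 < W i j) (hb : ∀ v ∈ U, 0 < b v) (i : V) :
    ∑' σ : ExitPaths G U i, ENNReal.ofReal (psiTerm G W U b i σ)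
      = walkSum G (fun i => ENNReal.ofReal (psiEnd U i))
          (fun i l => ENNReal.ofReal (stepWeight W U b i l)) i := by
  classical
  refine (tsum_subtype
    {σ : Σ j : V, G.Walk i j | σ.1 ∉ U ∧ ∀ v ∈ σ.2.support.dropLast, v ∈ U}
    (fun σ => ENNReal.ofReal (pathConductance W σ.2 / pathPotentialMinus b σ.2))).trans ?_
  refine tsum_congr fun σ => ?_
  rw [walkWeight_psi hW hb]
  simp [Set.indicator_apply]

lemma greenTerm_nonneg (hW : ∀ i j, G.Adj i j → 0 < W i j) (hb : ∀ v ∈ U, 0 < b v) (i j : V)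
    (σ : PathsIn G U i j) : 0 ≤ greenTerm G W U b i j σ :=
  div_nonneg (pathConductance_nonneg hW _) (pathPotential_pos hb _ σ.2).le

lemma psiTerm_nonneg (hW : ∀ i j, G.Adj i j → 0 < W i j) (hb : ∀ v ∈ U, 0 < b v) (i : V)
    (σ : ExitPaths G U i) : 0 ≤ psiTerm G W U b i σ :=
  div_nonneg (pathConductance_nonneg hW _) (pathPotentialMinus_pos hb _ σ.2.2).le

lemma summable_of_tsum_ofReal_ne_top {ι : Type*} {f : ι → ℝ} (hf : ∀ i, 0 ≤ f i)
    (h : ∑' i, ENNReal.ofReal (f i) ≠ ∞) : Summable f := by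
  have := ENNReal.summable_toReal h
  simpa only [ENNReal.toReal_ofReal (hf _)] using this

lemma tsum_eq_toReal_tsum_ofReal {ι : Type*} {f : ι → ℝ} (hf : ∀ i, 0 ≤ f i) :
    ∑' i, f i = (∑' i, ENNReal.ofReal (f i)).toReal := by
  rw [ENNReal.tsum_toReal_eq fun i => ENNReal.ofReal_ne_top]
  simp only [ENNReal.toReal_ofReal (hf _)]

end Terms

/-! ### Green functions of 2b - W on a finite set, and their identification with path sums -/

section Green

variable {V : Type*} {G : SimpleGraph V} {W : V → V → ℝ} {U : Finset V} {b : V → ℝ}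
  {X : V → V → ℝ}

variable (G W) in
open Classical in
/-- The conductances, extended by `0` to the pairs that are not edges. -/
def edgeWeight (i j : V) : ℝ := if G.Adj i j then W i j else 0

variable (G W U) in
open Classical in
/-- The total conductance of the edges from `i` to points outside `U`. -/
def boundaryWeight [G.LocallyFinite] (i : V) : ℝ := ∑ j ∈ G.neighborFinset i with j ∉ U, W i j

lemma edgeWeight_symm (hsymm : ∀ i j, W i j = W j i) (i j : V) :
    edgeWeight G W i j = edgeWeight G W j i := by
  classical
  rw [edgeWeight, edgeWeight, hsymm i j]
  exact if_congr (G.adj_comm i j) rfl rfl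

lemma edgeWeight_nonneg (hW : ∀ i j, G.Adj i j → 0 < W i j) (i j : V) :
    0 ≤ edgeWeight G W i j := by
  rw [edgeWeight]
  split_ifs with h
  exacts [(hW i j h).le, le_rfl]

lemma edgeWeight_of_adj {i j : V} (h : G.Adj i j) : edgeWeight G W i j = W i j := if_pos h

lemma edgeWeight_self (i : V) : edgeWeight G W i i = 0 := if_neg (G.loopless.irrefl i)

lemma boundaryWeight_nonneg [G.LocallyFinite] (hW : ∀ i j, G.Adj i j → 0 < W i j) (i : V) :
    0 ≤ boundaryWeight G W U i := by
  classical
  exact Finset.sum_nonneg fun j hj => (hW i j (by simpa using (Finset.mem_filter.1 hj).1)).le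

open Classical in
lemma sum_neighborFinset [G.LocallyFinite] (U : Finset V) (f : V → ℝ) (i : V) :
    ∑ l ∈ G.neighborFinset i, W i l * f l
      = ∑ l ∈ U, edgeWeight G W i l * f l
        + ∑ l ∈ G.neighborFinset i with l ∉ U, W i l * f l := by
  rw [← Finset.sum_filter_add_sum_filter_not _ (· ∈ U)]
  congr 1
  simp only [edgeWeight, ite_mul, zero_mul]
  rw [← Finset.sum_filter]
  refine Finset.sum_congr ?_ fun _ _ => rfl
  ext l
  simp [and_comm]

lemma boundaryWeight_cons [G.LocallyFinite] {k : V} (hk : k ∉ U) (i : V) :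
    boundaryWeight G W (U.cons k hk) i = boundaryWeight G W U i - edgeWeight G W i k := by
  classical
  have h1 := sum_neighborFinset (G := G) (W := W) U (fun _ => 1) i
  have h2 := sum_neighborFinset (G := G) (W := W) (U.cons k hk) (fun _ => 1) i
  simp only [mul_one, Finset.sum_cons] at h1 h2
  simp only [boundaryWeight]
  linarith

variable (G W U b X) in
/-- `X` is the Green function of the operator `2b - W` on `U`, extended by `0`. -/
structure IsGreen : Prop where
  pos : ∀ i ∈ U, 0 < b i
  left_zero : ∀ i j, i ∉ U → X i j = 0
  symm : ∀ i j, X i j = X j i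
  nonneg : ∀ i j, 0 ≤ X i j
  eqn : ∀ i ∈ U, ∀ j, 2 * b i * X i j - ∑ l ∈ U, edgeWeight G W i l * X l j
    = open Classical in if i = j then 1 else 0

lemma IsGreen.right_zero (hX : IsGreen G W U b X) (i j : V) (hj : j ∉ U) : X i j = 0 := by
  rw [hX.symm, hX.left_zero j i hj]

/-- Since `X` and `W` are symmetric, the right inverse `X` is also a left inverse: pair the equation
for `d` with the row of `X` at `i` and move the operator onto `X`. -/
lemma IsGreen.solve (hsymm : ∀ i j, W i j = W j i) (hX : IsGreen G W U b X) {d f : V → ℝ}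
    (hd : ∀ j ∈ U, 2 * b j * d j - ∑ l ∈ U, edgeWeight G W j l * d l = f j) {i : V} (hi : i ∈ U) :
    d i = ∑ j ∈ U, X i j * f j := by
  classical
  have h1 : ∑ j ∈ U, X i j * f j
      = ∑ l ∈ U, d l * (2 * b l * X l i - ∑ j ∈ U, edgeWeight G W l j * X j i) := by
    simp only [mul_sub, Finset.mul_sum, Finset.sum_sub_distrib]
    rw [Finset.sum_comm (s := U) (t := U) (f := fun l j => d l * (edgeWeight G W l j * X j i)),
      ← Finset.sum_sub_distrib]
    refine Finset.sum_congr rfl fun j hj => ?_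
    rw [← hd j hj, mul_sub, Finset.mul_sum, hX.symm i j]
    congr 1
    · ring
    · refine Finset.sum_congr rfl fun l _ => ?_
      rw [edgeWeight_symm hsymm j l]
      ring
  rw [h1, Finset.sum_eq_single i]
  · rw [hX.eqn i hi, if_pos rfl, mul_one]
  · intro l hl hli
    rw [hX.eqn l hl, if_neg hli, mul_zero]
  · exact fun h => absurd hi h

/-- A nonnegative solution of the first step equation dominates the walk sum, which is therefore
finite. The difference of the two solves the homogeneous equation on `U` and vanishes outside, so
the existence of a Green function forces it to be 0. Convergence of the path sums comes with the
identification. -/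
lemma walkSum_stepWeight [G.LocallyFinite] (hsymm : ∀ i j, W i j = W j i)
    (hW : ∀ i j, G.Adj i j → 0 < W i j)
    (hX : IsGreen G W U b X) {c x : V → ℝ} (hc : ∀ i, 0 ≤ c i) (hx0 : ∀ i, 0 ≤ x i)
    (hxU : ∀ i ∈ U, x i = c i + (∑ l ∈ G.neighborFinset i, W i l * x l) / (2 * b i))
    (hxU' : ∀ i, i ∉ U → x i = c i) (i : V) :
    walkSum G (fun i => ENNReal.ofReal (c i))
      (fun i l => ENNReal.ofReal (stepWeight W U b i l)) i = ENNReal.ofReal (x i) := by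
  classical
  set S := walkSum G (fun i => ENNReal.ofReal (c i))
      (fun i l => ENNReal.ofReal (stepWeight W U b i l)) with hS
  have hstep : ∀ i, ∀ l ∈ G.neighborFinset i, 0 ≤ stepWeight W U b i l := by
    intro i l hl
    rw [stepWeight]
    split_ifs with h
    · have h1 := hW i l (by simpa using hl)
      have h2 := hX.pos i h
      positivity
    · exact le_rfl
  have hx : ∀ i, x i = c i + ∑ l ∈ G.neighborFinset i, stepWeight W U b i l * x l := by
    intro i
    by_cases hi : i ∈ U
    · rw [hxU i hi, Finset.sum_div]
      simp only [stepWeight, if_pos hi]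
      congr 1
      exact Finset.sum_congr rfl fun l _ => by ring
    · simp [stepWeight, hi, hxU' i hi]
  have hle : ∀ i, S i ≤ ENNReal.ofReal (x i) := by
    refine walkSum_le fun i => le_of_eq ?_
    conv_rhs => rw [hx i]
    rw [ENNReal.ofReal_add (hc i)
      (Finset.sum_nonneg fun l hl => mul_nonneg (hstep i l hl) (hx0 l)),
      ENNReal.ofReal_sum_of_nonneg fun l hl => mul_nonneg (hstep i l hl) (hx0 l)]
    congr 1
    exact Finset.sum_congr rfl fun l hl => (ENNReal.ofReal_mul (hstep i l hl)).symm
  have hfin : ∀ i, S i ≠ ∞ := fun i => ne_top_of_le_ne_top ENNReal.ofReal_ne_top (hle i)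
  have hSr : ∀ i, (S i).toReal
      = c i + ∑ l ∈ G.neighborFinset i, stepWeight W U b i l * (S l).toReal := by
    intro i
    conv_lhs => rw [hS, walkSum_eq, ← hS]
    rw [ENNReal.toReal_add ENNReal.ofReal_ne_top
      (ENNReal.sum_ne_top.2 fun l _ => ENNReal.mul_ne_top ENNReal.ofReal_ne_top (hfin l)),
      ENNReal.toReal_ofReal (hc i),
      ENNReal.toReal_sum fun l _ => ENNReal.mul_ne_top ENNReal.ofReal_ne_top (hfin l)]
    congr 1
    refine Finset.sum_congr rfl fun l hl => ?_
    rw [ENNReal.toReal_mul, ENNReal.toReal_ofReal (hstep i l hl)]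
  set d : V → ℝ := fun i => x i - (S i).toReal with hd
  have hdeq : ∀ i, d i = ∑ l ∈ G.neighborFinset i, stepWeight W U b i l * d l := by
    intro i
    simp only [hd, mul_sub, Finset.sum_sub_distrib]
    linarith [hx i, hSr i]
  have hd0 : ∀ i, i ∉ U → d i = 0 := by
    intro i hi
    rw [hdeq i]
    simp [stepWeight, hi]
  have hdU : ∀ j ∈ U, 2 * b j * d j - ∑ l ∈ U, edgeWeight G W j l * d l = 0 := by
    intro j hj
    have h1 : 2 * b j * d j = ∑ l ∈ G.neighborFinset j, W j l * d l := by
      conv_lhs => rw [hdeq j, Finset.mul_sum]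
      refine Finset.sum_congr rfl fun l _ => ?_
      have := hX.pos j hj
      rw [stepWeight, if_pos hj]
      field_simp
    rw [h1, sum_neighborFinset U]
    rw [Finset.sum_eq_zero (s := {l ∈ G.neighborFinset j | l ∉ U})]
    · ring
    · intro l hl
      rw [hd0 l (Finset.mem_filter.1 hl).2, mul_zero]
  have hdz : d i = 0 := by
    by_cases hi : i ∈ U
    · rw [hX.solve hsymm hdU hi]
      simp
    · exact hd0 i hi
  rw [← ENNReal.ofReal_toReal (hfin i)]
  congr 1
  simp only [hd] at hdz
  linarith

section

variable [G.LocallyFinite] (hsymm : ∀ i j, W i j = W j i) (hW : ∀ i j, G.Adj i j → 0 < W i j)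
  (hX : IsGreen G W U b X)

include hsymm hW hX

lemma IsGreen.tsum_greenTerm (i j : V) :
    ∑' σ : PathsIn G U i j, ENNReal.ofReal (greenTerm G W U b i j σ) = ENNReal.ofReal (X i j) := by
  classical
  rw [VRJP.tsum_greenTerm hW hX.pos]
  refine walkSum_stepWeight hsymm hW hX (x := fun i => X i j) ?_ (fun i => hX.nonneg i j) ?_ ?_ i
  · intro i
    rw [greenEnd]
    split_ifs with h
    · have := hX.pos i h.2
      positivity
    · exact le_rfl
  · intro i hi
    have h1 := hX.eqn i hi j
    have h2 := hX.pos i hi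
    have h3 : ∑ l ∈ G.neighborFinset i with l ∉ U, W i l * X l j = 0 :=
      Finset.sum_eq_zero fun l hl => by
        rw [hX.left_zero l j (Finset.mem_filter.1 hl).2, mul_zero]
    rw [sum_neighborFinset U, h3, add_zero, sub_eq_iff_eq_add.1 h1 |> fun h => show X i j =
      ((if i = j then 1 else 0) + ∑ l ∈ U, edgeWeight G W i l * X l j) / (2 * b i) by
        rw [← h]; field_simp, add_div]
    congr 1
    simp only [greenEnd, hi, and_true]
    split_ifs <;> simp
  · intro i hi
    simp [greenEnd, hi, hX.left_zero i j hi]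

lemma IsGreen.summable_greenTerm (i j : V) : Summable (greenTerm G W U b i j) :=
  summable_of_tsum_ofReal_ne_top (greenTerm_nonneg hW hX.pos i j)
    (by rw [hX.tsum_greenTerm hsymm hW]; exact ENNReal.ofReal_ne_top)

lemma IsGreen.greenHat_eq (i j : V) : greenHat G W U b i j = X i j := by
  rw [greenHat]
  split_ifs with h
  · rw [tsum_eq_toReal_tsum_ofReal (greenTerm_nonneg hW hX.pos i j), hX.tsum_greenTerm hsymm hW,
      ENNReal.toReal_ofReal (hX.nonneg i j)]
  · by_cases hi : i ∈ U
    · rw [hX.right_zero i j fun hj => h ⟨hi, hj⟩]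
    · rw [hX.left_zero i j hi]

/-- ψ solves (2b - W)ψ = 0 on `U` with boundary value 1. Moving the boundary values to the right
side leaves the boundary conductances as source term. -/
lemma IsGreen.tsum_psiTerm {i : V} (hi : i ∈ U) :
    ∑' σ : ExitPaths G U i, ENNReal.ofReal (psiTerm G W U b i σ)
      = ENNReal.ofReal (∑ j ∈ U, X i j * boundaryWeight G W U j) := by
  classical
  have hnn : ∀ i, 0 ≤ ∑ j ∈ U, X i j * boundaryWeight G W U j := fun i =>
    Finset.sum_nonneg fun j _ => mul_nonneg (hX.nonneg i j) (boundaryWeight_nonneg hW j)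
  rw [VRJP.tsum_psiTerm hW hX.pos,
    walkSum_stepWeight hsymm hW hX
      (x := fun i => if i ∈ U then ∑ j ∈ U, X i j * boundaryWeight G W U j else 1)]
  · simp [hi]
  · intro i
    rw [psiEnd]
    split_ifs <;> norm_num
  · intro i
    split_ifs
    exacts [hnn i, zero_le_one]
  · intro i hi
    have h2 := hX.pos i hi
    have h4 : ∑ l ∈ U, edgeWeight G W i l *
        (if l ∈ U then ∑ j ∈ U, X l j * boundaryWeight G W U j else 1)
        = ∑ l ∈ U, edgeWeight G W i l * ∑ j ∈ U, X l j * boundaryWeight G W U j :=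
      Finset.sum_congr rfl fun l hl => by rw [if_pos hl]
    have h5 : ∑ l ∈ G.neighborFinset i with l ∉ U, W i l *
        (if l ∈ U then ∑ j ∈ U, X l j * boundaryWeight G W U j else 1)
        = boundaryWeight G W U i :=
      Finset.sum_congr rfl fun l hl => by rw [if_neg (Finset.mem_filter.1 hl).2, mul_one]
    have h6 : 2 * b i * ∑ j ∈ U, X i j * boundaryWeight G W U j
        - ∑ l ∈ U, edgeWeight G W i l * ∑ j ∈ U, X l j * boundaryWeight G W U j
        = boundaryWeight G W U i := by
      simp only [Finset.mul_sum]
      rw [Finset.sum_comm (s := U) (t := U), ← Finset.sum_sub_distrib]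
      have : ∀ j ∈ U, 2 * b i * (X i j * boundaryWeight G W U j)
          - ∑ l ∈ U, edgeWeight G W i l * (X l j * boundaryWeight G W U j)
          = (if i = j then 1 else 0) * boundaryWeight G W U j := by
        intro j hj
        rw [← hX.eqn i hi j, sub_mul, Finset.sum_mul, ← mul_assoc]
        congr 1
        exact Finset.sum_congr rfl fun l _ => by ring
      rw [Finset.sum_congr rfl this]
      simp [hi]
    rw [sum_neighborFinset U, h4, h5, if_pos hi, psiEnd, if_pos hi, zero_add]
    field_simp
    linarith
  · intro i hi
    simp [psiEnd, hi]

lemma IsGreen.summable_psiTerm {i : V} (hi : i ∈ U) : Summable (psiTerm G W U b i) :=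
  summable_of_tsum_ofReal_ne_top (psiTerm_nonneg hW hX.pos i)
    (by rw [hX.tsum_psiTerm hsymm hW hi]; exact ENNReal.ofReal_ne_top)

lemma IsGreen.psi_eq {i : V} (hi : i ∈ U) :
    psi G W U b i = ∑ j ∈ U, X i j * boundaryWeight G W U j := by
  rw [psi, if_pos hi, tsum_eq_toReal_tsum_ofReal (psiTerm_nonneg hW hX.pos i),
    hX.tsum_psiTerm hsymm hW hi, ENNReal.toReal_ofReal
      (Finset.sum_nonneg fun j _ => mul_nonneg (hX.nonneg i j) (boundaryWeight_nonneg hW j))]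

end

end Green

/-! ### Adding one point: Schur complement and rank one update -/

section Schur

variable {V : Type*} (G : SimpleGraph V) (W : V → V → ℝ) (U : Finset V) (X : V → V → ℝ) (k : V)

/-- The image under the Green function of the conductances to `k`. -/
def hitting (i : V) : ℝ := ∑ j ∈ U, X i j * edgeWeight G W j k

/-- The term by which the Schur complement of `U` at `k` differs from `2 b k`. -/
def schurShift : ℝ := ∑ i ∈ U, edgeWeight G W k i * hitting G W U X k i

/-- The total boundary conductance seen from `k` when `U` is eliminated. -/
def schurDrift [G.LocallyFinite] (hk : k ∉ U) : ℝ :=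
  boundaryWeight G W (U.cons k hk) k
    + ∑ i ∈ U, hitting G W U X k i * boundaryWeight G W (U.cons k hk) i

/-- The quadratic form `⟨lam, ψ⟩ + ½ ⟨lam, Ĝ lam⟩` on `U`. -/
def greenForm (b lam : V → ℝ) : ℝ :=
  ∑ i ∈ U, lam i * psi G W U b i
    + 1 / 2 * ∑ i ∈ U, ∑ j ∈ U, lam i * greenHat G W U b i j * lam j

variable {G W U X k} {b : V → ℝ} (hsymm : ∀ i j, W i j = W j i)
  (hW : ∀ i j, G.Adj i j → 0 < W i j) (hX : IsGreen G W U b X)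

include hW hX

lemma IsGreen.hitting_nonneg (i : V) : 0 ≤ hitting G W U X k i :=
  Finset.sum_nonneg fun j _ => mul_nonneg (hX.nonneg i j) (edgeWeight_nonneg hW j k)

lemma IsGreen.schurShift_nonneg : 0 ≤ schurShift G W U X k :=
  Finset.sum_nonneg fun i _ => mul_nonneg (edgeWeight_nonneg hW k i) (hX.hitting_nonneg hW i)

lemma IsGreen.schurDrift_nonneg [G.LocallyFinite] (hk : k ∉ U) :
    0 ≤ schurDrift G W U X k hk :=
  add_nonneg (boundaryWeight_nonneg hW k) (Finset.sum_nonneg fun i _ =>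
    mul_nonneg (hX.hitting_nonneg hW i) (boundaryWeight_nonneg hW i))

omit hW in
lemma IsGreen.hitting_eq_zero {i : V} (hi : i ∉ U) : hitting G W U X k i = 0 :=
  Finset.sum_eq_zero fun j _ => by rw [hX.left_zero i j hi, zero_mul]

omit hW in
include hsymm in
lemma IsGreen.sum_edgeWeight_mul (j : V) :
    ∑ l ∈ U, edgeWeight G W k l * X l j = hitting G W U X k j :=
  Finset.sum_congr rfl fun l _ => by rw [hX.symm j l, edgeWeight_symm hsymm l k, mul_comm]

omit hW in
lemma IsGreen.eqn_hitting {i : V} (hi : i ∈ U) :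
    2 * b i * hitting G W U X k i - ∑ l ∈ U, edgeWeight G W i l * hitting G W U X k l
      = edgeWeight G W i k := by
  classical
  simp only [hitting, Finset.mul_sum]
  rw [Finset.sum_comm (s := U) (t := U), ← Finset.sum_sub_distrib]
  have : ∀ j ∈ U, 2 * b i * (X i j * edgeWeight G W j k)
      - ∑ l ∈ U, edgeWeight G W i l * (X l j * edgeWeight G W j k)
      = (if i = j then 1 else 0) * edgeWeight G W j k := by
    intro j hj
    rw [← hX.eqn i hi j, sub_mul, Finset.sum_mul, ← mul_assoc]
    congr 1
    exact Finset.sum_congr rfl fun l _ => by ring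
  rw [Finset.sum_congr rfl this]
  simp [hi]

variable (G W U X k) in
omit hW hX in
open Classical in
/-- The vector `hitting`, extended by the value `1` at the point `k`. -/
def hittingExt (i : V) : ℝ := hitting G W U X k i + if i = k then 1 else 0

-- Block inversion: the inverse on `U ∪ {k}` is the old one, extended by 0, plus the rank one matrix
-- of the vector (hitting, 1) divided by the Schur complement. Positivity of the latter preserves
-- nonnegativity of the entries, and `2 * b k > 0` because the shift is nonnegative.
include hsymm in
lemma IsGreen.cons (hk : k ∉ U) (hy : 0 < 2 * b k - schurShift G W U X k) :
    IsGreen G W (U.cons k hk) b fun i j =>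
      X i j + hittingExt G W U X k i * hittingExt G W U X k j
        / (2 * b k - schurShift G W U X k) := by
  classical
  have hkU : ∀ i ∈ U, i ≠ k := fun i hi h => hk (h ▸ hi)
  have hE : ∀ i ∈ U, hittingExt G W U X k i = hitting G W U X k i := fun i hi => by
    rw [hittingExt, if_neg (hkU i hi), add_zero]
  have hEk : hittingExt G W U X k k = 1 := by
    rw [hittingExt, if_pos rfl, hX.hitting_eq_zero hk, zero_add]
  have hE0 : ∀ i, 0 ≤ hittingExt G W U X k i := fun i => by
    have := hX.hitting_nonneg hW (k := k) i
    rw [hittingExt]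
    split_ifs <;> linarith
  set y := 2 * b k - schurShift G W U X k with hydef
  refine ⟨?_, ?_, ?_, ?_, ?_⟩
  · intro i hi
    rcases Finset.mem_cons.1 hi with rfl | hi
    · have := hX.schurShift_nonneg hW (k := i)
      linarith
    · exact hX.pos i hi
  · intro i j hi
    rw [Finset.mem_cons, not_or] at hi
    rw [hX.left_zero i j hi.2, hittingExt, if_neg hi.1, hX.hitting_eq_zero hi.2]
    simp
  · intro i j
    rw [hX.symm i j, mul_comm (hittingExt G W U X k i)]
  · intro i j
    have := hX.nonneg i j
    have := mul_nonneg (hE0 i) (hE0 j)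
    positivity
  · intro i hi j
    have hsum : ∑ l ∈ U, edgeWeight G W i l *
          (X l j + hittingExt G W U X k l * hittingExt G W U X k j / y)
        = ∑ l ∈ U, edgeWeight G W i l * X l j
          + (∑ l ∈ U, edgeWeight G W i l * hitting G W U X k l) * (hittingExt G W U X k j / y) := by
      rw [Finset.sum_mul, ← Finset.sum_add_distrib]
      refine Finset.sum_congr rfl fun l hl => ?_
      rw [hE l hl]
      ring
    rw [Finset.sum_cons, hsum, hEk, hX.left_zero k j hk]
    rcases Finset.mem_cons.1 hi with rfl | hi
    · rw [hX.left_zero i j hk, hEk, edgeWeight_self, hX.sum_edgeWeight_mul hsymm,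
        show ∑ l ∈ U, edgeWeight G W i l * hitting G W U X i l = schurShift G W U X i from rfl]
      have h1 : (if i = j then (1 : ℝ) else 0)
          = hittingExt G W U X i j - hitting G W U X i j := by
        rw [hittingExt]
        simp [eq_comm]
      rw [h1]
      have : 2 * b i = y + schurShift G W U X i := by rw [hydef]; ring
      rw [this]
      field_simp
      ring
    · rw [hE i hi, ← hX.eqn i hi j]
      have := hX.eqn_hitting (k := k) hi
      rw [← this]
      ring

variable [G.LocallyFinite]

include hsymm

/-- `hitting` and ψ are the images under the same symmetric matrix of the conductances to `k` and of
the boundary conductances. -/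
lemma IsGreen.sum_hitting_mul_boundaryWeight :
    ∑ i ∈ U, hitting G W U X k i * boundaryWeight G W U i
      = ∑ i ∈ U, edgeWeight G W k i * psi G W U b i := by
  have h1 : ∀ i ∈ U, edgeWeight G W k i * psi G W U b i
      = ∑ j ∈ U, edgeWeight G W k i * X i j * boundaryWeight G W U j := fun i hi => by
    rw [hX.psi_eq hsymm hW hi, Finset.mul_sum]
    exact Finset.sum_congr rfl fun j _ => by ring
  rw [Finset.sum_congr rfl h1, Finset.sum_comm]
  refine Finset.sum_congr rfl fun j _ => ?_
  rw [← Finset.sum_mul, hX.sum_edgeWeight_mul hsymm]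

omit hsymm hW hX in
lemma sum_mul_boundaryWeight_cons (hk : k ∉ U) (f : V → ℝ) :
    ∑ i ∈ U, f i * boundaryWeight G W (U.cons k hk) i
      = ∑ i ∈ U, f i * boundaryWeight G W U i - ∑ i ∈ U, f i * edgeWeight G W i k := by
  rw [← Finset.sum_sub_distrib]
  exact Finset.sum_congr rfl fun i _ => by rw [boundaryWeight_cons]; ring

/-- The edges from `U` to `k` stop being boundary edges when `k` is added, and the loss, weighted by
`hitting`, is the Schur shift. -/
lemma IsGreen.schurDrift_eq (hk : k ∉ U) :
    schurDrift G W U X k hk = boundaryWeight G W (U.cons k hk) k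
      + ∑ i ∈ U, edgeWeight G W k i * psi G W U b i - schurShift G W U X k := by
  rw [schurDrift, sum_mul_boundaryWeight_cons,
    hX.sum_hitting_mul_boundaryWeight hsymm hW, schurShift, add_sub_assoc]
  congr 2
  exact Finset.sum_congr rfl fun i _ => by rw [edgeWeight_symm hsymm i k, mul_comm]

/-- Integrating out the potential at `k` shifts λ by a multiple of the conductances to `k`; this is
the resulting change of the quadratic form. -/
lemma IsGreen.greenForm_add (lam : V → ℝ) (r : ℝ) :
    greenForm G W U b (fun i => lam i + r * edgeWeight G W k i)
      = greenForm G W U b lam + r * ∑ i ∈ U, edgeWeight G W k i * psi G W U b i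
        + r * ∑ i ∈ U, lam i * hitting G W U X k i + 1 / 2 * r ^ 2 * schurShift G W U X k := by
  simp only [greenForm, hX.greenHat_eq hsymm hW]
  have h1 : ∑ i ∈ U, ∑ j ∈ U, (lam i + r * edgeWeight G W k i) * X i j
        * (lam j + r * edgeWeight G W k j)
      = ∑ i ∈ U, ∑ j ∈ U, lam i * X i j * lam j
        + r * (∑ i ∈ U, ∑ j ∈ U, lam i * X i j * edgeWeight G W k j)
        + r * (∑ i ∈ U, ∑ j ∈ U, edgeWeight G W k i * X i j * lam j)
        + r ^ 2 * (∑ i ∈ U, ∑ j ∈ U, edgeWeight G W k i * X i j * edgeWeight G W k j) := by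
    simp only [Finset.mul_sum, ← Finset.sum_add_distrib]
    exact Finset.sum_congr rfl fun i _ => Finset.sum_congr rfl fun j _ => by ring
  have h2 : ∀ f : V → ℝ, ∑ i ∈ U, ∑ j ∈ U, f i * X i j * edgeWeight G W k j
      = ∑ i ∈ U, f i * hitting G W U X k i := fun f =>
    Finset.sum_congr rfl fun i _ => by
      rw [hitting, Finset.mul_sum]
      exact Finset.sum_congr rfl fun j _ => by rw [edgeWeight_symm hsymm k j]; ring
  have h3 : ∑ i ∈ U, ∑ j ∈ U, edgeWeight G W k i * X i j * lam j
      = ∑ i ∈ U, lam i * hitting G W U X k i := by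
    rw [Finset.sum_comm, ← h2]
    exact Finset.sum_congr rfl fun i _ => Finset.sum_congr rfl fun j _ => by
      rw [hX.symm i j]; ring
  rw [h1, h2, h2, h3, show ∑ i ∈ U, edgeWeight G W k i * hitting G W U X k i
    = schurShift G W U X k from rfl]
  simp only [add_mul, Finset.sum_add_distrib, mul_assoc, ← Finset.mul_sum]
  ring

/-- Let s = λ_k + ∑ λ_i h_i, let a be the drift and y the Schur complement. The rank one update adds
s a / y through ψ and ½ s² / y through Ĝ, together ½((a + s)² - a²) / y. The subtracted sum is the
boundary weight that `U` loses to `k`. The difference of squares is kept because the term -a²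
cancels against the density of √y. -/
lemma IsGreen.greenForm_cons (hk : k ∉ U) (hy : 0 < 2 * b k - schurShift G W U X k)
    (lam : V → ℝ) :
    greenForm G W (U.cons k hk) b lam
      = greenForm G W U b lam - ∑ i ∈ U, lam i * hitting G W U X k i
        + 1 / 2 * ((schurDrift G W U X k hk + (lam k + ∑ i ∈ U, lam i * hitting G W U X k i)) ^ 2
            - schurDrift G W U X k hk ^ 2) / (2 * b k - schurShift G W U X k) := by
  classical
  have hkU : ∀ i ∈ U, i ≠ k := fun i hi h => hk (h ▸ hi)
  have hE : ∀ i ∈ U, hittingExt G W U X k i = hitting G W U X k i := fun i hi => by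
    rw [hittingExt, if_neg (hkU i hi), add_zero]
  have hEk : hittingExt G W U X k k = 1 := by
    rw [hittingExt, if_pos rfl, hX.hitting_eq_zero hk, zero_add]
  have hX' := hX.cons hsymm hW hk hy
  set y := 2 * b k - schurShift G W U X k with hydef
  have hs : ∀ f : V → ℝ, ∑ j ∈ U.cons k hk, hittingExt G W U X k j * f j
      = f k + ∑ j ∈ U, f j * hitting G W U X k j := fun f => by
    rw [Finset.sum_cons, hEk, one_mul]
    congr 1
    exact Finset.sum_congr rfl fun j hj => by rw [hE j hj, mul_comm]
  have hdrift : schurDrift G W U X k hk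
      = ∑ j ∈ U.cons k hk, hittingExt G W U X k j * boundaryWeight G W (U.cons k hk) j := by
    rw [hs, schurDrift]
    congr 1
    exact Finset.sum_congr rfl fun j _ => mul_comm _ _
  have hpsi : ∀ i ∈ U.cons k hk, psi G W (U.cons k hk) b i
      = ∑ j ∈ U, X i j * boundaryWeight G W (U.cons k hk) j
        + hittingExt G W U X k i * schurDrift G W U X k hk / y := by
    intro i hi
    rw [hX'.psi_eq hsymm hW hi, hdrift, mul_div_right_comm, Finset.mul_sum]
    simp only [add_mul, Finset.sum_add_distrib]
    congr 1
    · rw [Finset.sum_cons, hX.right_zero i k hk, zero_mul, zero_add]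
    · exact Finset.sum_congr rfl fun j _ => by ring
  have h1 : ∑ i ∈ U.cons k hk, lam i * psi G W (U.cons k hk) b i
      = ∑ i ∈ U, lam i * psi G W U b i - ∑ i ∈ U, lam i * hitting G W U X k i
        + (lam k + ∑ i ∈ U, lam i * hitting G W U X k i) * schurDrift G W U X k hk / y := by
    have e1 : ∀ i ∈ U.cons k hk, lam i * psi G W (U.cons k hk) b i
        = lam i * ∑ j ∈ U, X i j * boundaryWeight G W (U.cons k hk) j
          + hittingExt G W U X k i * lam i * (schurDrift G W U X k hk / y) := fun i hi => by
      rw [hpsi i hi]; ring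
    rw [Finset.sum_congr rfl e1, Finset.sum_add_distrib, ← Finset.sum_mul, hs lam, Finset.sum_cons]
    have e2 : ∑ j ∈ U, X k j * boundaryWeight G W (U.cons k hk) j = 0 :=
      Finset.sum_eq_zero fun j _ => by rw [hX.left_zero k j hk, zero_mul]
    rw [e2, mul_zero, zero_add, mul_div_assoc, ← Finset.sum_sub_distrib]
    congr 1
    refine Finset.sum_congr rfl fun i hi => ?_
    rw [sum_mul_boundaryWeight_cons hk, hX.psi_eq hsymm hW hi, mul_sub, hitting]
  have h2 : ∑ i ∈ U.cons k hk, ∑ j ∈ U.cons k hk,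
        lam i * greenHat G W (U.cons k hk) b i j * lam j
      = ∑ i ∈ U, ∑ j ∈ U, lam i * greenHat G W U b i j * lam j
        + (lam k + ∑ i ∈ U, lam i * hitting G W U X k i) ^ 2 / y := by
    have e1 : ∀ i j, lam i * greenHat G W (U.cons k hk) b i j * lam j
        = lam i * X i j * lam j + hittingExt G W U X k i * lam i
          * (hittingExt G W U X k j * lam j) / y := fun i j => by
      rw [hX'.greenHat_eq hsymm hW]; ring
    simp only [e1, Finset.sum_add_distrib, ← Finset.sum_div, ← Finset.mul_sum, ← Finset.sum_mul,
      hs lam, hX.greenHat_eq hsymm hW]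
    rw [sq]
    congr 1
    rw [Finset.sum_cons, Finset.sum_eq_zero fun j _ => by rw [hX.left_zero k j hk]; ring, zero_add]
    refine Finset.sum_congr rfl fun i _ => ?_
    rw [Finset.sum_cons, hX.right_zero i k hk]
    ring
  rw [greenForm, h1, h2, greenForm]
  ring

end Schur

/-! ### The Gaussian integral under the substitution u = t x - a / x -/

section Integral

open Set Real

lemma lintegral_exp_neg_sq_half :
    ∫⁻ u : ℝ, ENNReal.ofReal (exp (-(1 / 2) * u ^ 2)) = ENNReal.ofReal √(2 * π) := by
  rw [← ofReal_integral_eq_lintegral_ofReal (integrable_exp_neg_mul_sq (by norm_num))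
    (ae_of_all _ fun u => (exp_pos _).le), integral_gaussian]
  congr 2
  ring

lemma image_mul_sub_div_Ioi {t a : ℝ} (ht : 0 < t) (ha : 0 < a) :
    (fun x => t * x - a / x) '' Ioi 0 = univ := by
  refine eq_univ_of_forall fun u => ?_
  have h1 : |u| < √(u ^ 2 + 4 * (a * t)) := by
    rw [← sqrt_sq_eq_abs]
    exact sqrt_lt_sqrt (sq_nonneg u) (by nlinarith [mul_pos ha ht])
  have h2 : √(u ^ 2 + 4 * (a * t)) ^ 2 = u ^ 2 + 4 * (a * t) :=
    sq_sqrt (by nlinarith [mul_pos ha ht, sq_nonneg u])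
  set s := √(u ^ 2 + 4 * (a * t))
  have h3 : 0 < u + s := by linarith [neg_abs_le u]
  -- The positive root of t x² - u x - a = 0.
  refine ⟨(u + s) / (2 * t), by simpa using div_pos h3 (by positivity), ?_⟩
  dsimp only
  field_simp
  linarith

lemma injOn_mul_sub_div_Ioi {t a : ℝ} (ht : 0 < t) (ha : 0 < a) :
    InjOn (fun x => t * x - a / x) (Ioi 0) := by
  refine StrictMonoOn.injOn fun x hx y hy hxy => ?_
  have h1 : t * x < t * y := mul_lt_mul_of_pos_left hxy ht
  have h2 : a / y < a / x := div_lt_div_of_pos_left ha hx hxy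
  linarith

lemma lintegral_exp_neg_mul_sub_div_sq {t a : ℝ} (ht : 0 < t) (ha : 0 < a) :
    ∫⁻ x in Ioi (0 : ℝ), ENNReal.ofReal (exp (-(1 / 2) * (t * x - a / x) ^ 2))
      = ENNReal.ofReal (√(2 * π) / (2 * t)) := by
  set K := ∫⁻ x in Ioi (0 : ℝ), ENNReal.ofReal (exp (-(1 / 2) * (t * x - a / x) ^ 2)) with hK
  set L := ∫⁻ x in Ioi (0 : ℝ), ENNReal.ofReal (a / x ^ 2)
    * ENNReal.ofReal (exp (-(1 / 2) * (t * x - a / x) ^ 2)) with hL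
  -- The substitution u = t x - a / x has derivative t + a / x², so the full Gaussian integral
  -- splits into `t * K` and `L`.
  have hgauss : ENNReal.ofReal √(2 * π) = ENNReal.ofReal t * K + L := by
    have h := lintegral_image_eq_lintegral_abs_deriv_mul (f := fun x => t * x - a / x)
      (f' := fun x => t + a / x ^ 2) measurableSet_Ioi
      (fun x hx => by
        have hx0 : x ≠ 0 := ne_of_gt hx
        have := ((hasDerivAt_id x).const_mul t).sub (((hasDerivAt_inv hx0).const_mul a))
        refine (this.congr_deriv ?_).hasDerivWithinAt
        field_simp
        ring)
      (injOn_mul_sub_div_Ioi ht ha) (fun u => ENNReal.ofReal (exp (-(1 / 2) * u ^ 2)))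
    rw [image_mul_sub_div_Ioi ht ha, setLIntegral_univ, lintegral_exp_neg_sq_half] at h
    rw [h, hK, hL, ← lintegral_const_mul _ (by fun_prop), ← lintegral_add_left (by fun_prop)]
    refine setLIntegral_congr_fun measurableSet_Ioi fun x hx => ?_
    have hx0 : (0 : ℝ) < x := hx
    rw [← add_mul, ← ENNReal.ofReal_add ht.le (by positivity), abs_of_pos (by positivity)]
  -- The inversion x ↦ a / (t x) changes the sign of t x - a / x and exchanges the two pieces, so
  -- each is half of the Gaussian integral.
  have hinv : ENNReal.ofReal t * K = L := by
    have himg : (fun x => a / (t * x)) '' Ioi 0 = Ioi 0 := by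
      ext x
      refine ⟨?_, fun hx => ⟨a / (t * x), ?_, ?_⟩⟩
      · rintro ⟨y, hy, rfl⟩
        exact div_pos ha (mul_pos ht hy)
      · exact div_pos ha (mul_pos ht hx)
      · have : x ≠ 0 := ne_of_gt hx
        dsimp only
        field_simp
    have h := lintegral_image_eq_lintegral_abs_deriv_mul (f := fun x => a / (t * x))
      (f' := fun x => -(a / t / x ^ 2)) measurableSet_Ioi
      (fun x hx => by
        have hx0 : x ≠ 0 := ne_of_gt hx
        have := ((hasDerivAt_inv hx0).const_mul (a / t))
        have e : (fun x => a / (t * x)) = fun x => a / t * x⁻¹ := by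
          ext x; rw [← div_div]; rfl
        rw [e]
        refine (this.congr_deriv ?_).hasDerivWithinAt
        field_simp)
      (fun x hx y hy hxy => by
        have hx0 : x ≠ 0 := ne_of_gt hx
        have hy0 : y ≠ 0 := ne_of_gt hy
        dsimp only at hxy
        field_simp at hxy
        exact hxy.symm)
      (fun x => ENNReal.ofReal (exp (-(1 / 2) * (t * x - a / x) ^ 2)))
    rw [himg, ← hK] at h
    rw [h, hL, ← lintegral_const_mul _ (by fun_prop)]
    refine setLIntegral_congr_fun measurableSet_Ioi fun x hx => ?_
    have hx0 : (0 : ℝ) < x := hx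
    rw [abs_neg, abs_of_pos (by positivity), ← mul_assoc, ← ENNReal.ofReal_mul ht.le]
    congr 2
    · field_simp
    · congr 2
      field_simp
      ring
  rw [← hinv, ← two_mul, ← mul_assoc, show (2 : ℝ≥0∞) = ENNReal.ofReal 2 by simp,
    ← ENNReal.ofReal_mul zero_le_two] at hgauss
  rw [ENNReal.ofReal_div_of_pos (by positivity)]
  exact (ENNReal.eq_div_iff (by simpa using ht) ENNReal.ofReal_ne_top).2 hgauss.symm

/-- Complete the square: t² x² + a² / x² = (t x - a / x)² + 2 a t. For a = 0 the substitution is no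
longer onto the line, and the integral is a half Gaussian. -/
lemma lintegral_exp_neg_sq_add_inv_sq {t a : ℝ} (ht : 0 < t) (ha : 0 ≤ a) :
    ∫⁻ x in Ioi (0 : ℝ), ENNReal.ofReal
        (√(2 / π) * exp (-(1 / 2) * (t ^ 2 * x ^ 2 + a ^ 2 / x ^ 2)))
      = ENNReal.ofReal (exp (-(a * t)) / t) := by
  have hconst : √(2 / π) * (√(2 * π) / (2 * t)) = 1 / t := by
    have : √(2 / π) * √(2 * π) = 2 := by
      rw [← sqrt_mul (by positivity), show 2 / π * (2 * π) = 2 ^ 2 by field_simp]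
      exact sqrt_sq zero_le_two
    rw [← mul_div_assoc, this]
    field_simp
  rcases ha.eq_or_lt with rfl | ha
  · have h1 : ∀ x : ℝ, √(2 / π) * exp (-(1 / 2) * (t ^ 2 * x ^ 2 + 0 ^ 2 / x ^ 2))
        = √(2 / π) * exp (-(t ^ 2 / 2) * x ^ 2) := fun x => by
      congr 2
      simp
      ring
    simp only [h1]
    rw [← ofReal_integral_eq_lintegral_ofReal, integral_const_mul, integral_gaussian_Ioi]
    · congr 1
      rw [show π / (t ^ 2 / 2) = 2 * π / t ^ 2 by field_simp, sqrt_div (by positivity) (t ^ 2),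
        sqrt_sq ht.le, div_div, mul_comm t 2, hconst]
      simp
    · exact ((integrable_exp_neg_mul_sq (by positivity)).const_mul _).integrableOn
    · exact ae_of_all _ fun x => by positivity
  · have h1 : ∀ x ∈ Ioi (0 : ℝ), ENNReal.ofReal
          (√(2 / π) * exp (-(1 / 2) * (t ^ 2 * x ^ 2 + a ^ 2 / x ^ 2)))
        = ENNReal.ofReal (√(2 / π) * exp (-(a * t)))
          * ENNReal.ofReal (exp (-(1 / 2) * (t * x - a / x) ^ 2)) := fun x hx => by
      have hx0 : x ≠ 0 := ne_of_gt hx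
      rw [← ENNReal.ofReal_mul (by positivity), mul_assoc, ← exp_add]
      congr 3
      field_simp
      ring
    rw [setLIntegral_congr_fun measurableSet_Ioi h1, lintegral_const_mul _ (by fun_prop),
      lintegral_exp_neg_mul_sub_div_sq ht ha, ← ENNReal.ofReal_mul (by positivity)]
    congr 1
    rw [mul_comm √(2 / π), mul_assoc, hconst]
    ring

end Integral

/-! ### Uniqueness of the multivariate Laplace transform for nonnegative variables -/

section LaplaceUniqueness

open scoped NNReal
open BoundedContinuousFunction

section Orthant

variable {ι : Type*} [Fintype ι]

/-- The function `x ↦ exp (-⟨m, x⟩)` on the orthant. -/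
def expNegBCF (m : ι → ℝ≥0) : (ι → ℝ≥0) →ᵇ ℝ :=
  BoundedContinuousFunction.ofNormedAddCommGroup
    (fun x => Real.exp (-∑ i, (m i : ℝ) * x i)) (by fun_prop) 1 fun x => by
      rw [Real.norm_of_nonneg (Real.exp_pos _).le, Real.exp_le_one_iff, neg_nonpos]
      positivity

lemma expNegBCF_apply (m x : ι → ℝ≥0) :
    expNegBCF m x = Real.exp (-∑ i, (m i : ℝ) * x i) := rfl

variable (ι) in
/-- The algebra spanned by the functions `expNegBCF m`. -/
def expNegAlgebra : StarSubalgebra ℝ ((ι → ℝ≥0) →ᵇ ℝ) where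
  toSubalgebra := (Submodule.span ℝ (Set.range (expNegBCF (ι := ι)))).toSubalgebra
    (Submodule.subset_span ⟨0, by ext x; simp [expNegBCF_apply]⟩)
    (fun f g hf hg => by
      have h := Submodule.mul_mem_mul hf hg
      rw [Submodule.span_mul_span] at h
      refine Submodule.span_mono ?_ h
      rintro _ ⟨_, ⟨m, rfl⟩, _, ⟨n, rfl⟩, rfl⟩
      refine ⟨m + n, ?_⟩
      ext x
      simp only [BoundedContinuousFunction.mul_apply, expNegBCF_apply, ← Real.exp_add,
        Pi.add_apply, NNReal.coe_add, add_mul, Finset.sum_add_distrib, neg_add])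
  star_mem' {f} hx := by
    have : star f = f := by ext x; simp
    rwa [this]

lemma mem_expNegAlgebra {f : (ι → ℝ≥0) →ᵇ ℝ} :
    f ∈ expNegAlgebra ι ↔ f ∈ Submodule.span ℝ (Set.range (expNegBCF (ι := ι))) := Iff.rfl

/-- A finite measure on the orthant is determined by its Laplace transform. -/
lemma measure_ext_of_laplace {μ ν : Measure (ι → ℝ≥0)} [IsFiniteMeasure μ] [IsFiniteMeasure ν]
    (h : ∀ m : ι → ℝ≥0, ∫ x, Real.exp (-∑ i, (m i : ℝ) * x i) ∂μ
      = ∫ x, Real.exp (-∑ i, (m i : ℝ) * x i) ∂ν) : μ = ν := by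
  classical
  -- On the orthant the exponentials are bounded and continuous, and their span is an algebra with
  -- unit. It separates points, so it determines finite measures on this complete separable space.
  refine ext_of_forall_mem_subalgebra_integral_eq_of_pseudoEMetric_complete_countable
    (A := expNegAlgebra ι) ?_ ?_
  · intro x y hxy
    obtain ⟨i, hi⟩ := Function.ne_iff.1 hxy
    refine ⟨expNegBCF (Pi.single i 1), ⟨_, ⟨expNegBCF (Pi.single i 1),
      mem_expNegAlgebra.2 (Submodule.subset_span ⟨_, rfl⟩), rfl⟩, rfl⟩, ?_⟩
    have hs : ∀ z : ι → ℝ≥0, ∑ j, ((Pi.single i 1 : ι → ℝ≥0) j : ℝ) * z j = z i := fun z => by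
      rw [Finset.sum_eq_single i] <;> simp +contextual
    change expNegBCF (Pi.single i 1) x ≠ expNegBCF (Pi.single i 1) y
    rw [expNegBCF_apply, expNegBCF_apply, hs, hs]
    simpa using hi
  · intro g hg
    refine Submodule.span_induction (p := fun g _ => ∫ x, g x ∂μ = ∫ x, g x ∂ν)
      ?_ ?_ ?_ ?_ (mem_expNegAlgebra.1 hg)
    · rintro _ ⟨m, rfl⟩
      exact h m
    · simp
    · intro f g _ _ hf hg
      simp only [BoundedContinuousFunction.add_apply]
      rw [integral_add (f.integrable μ) (g.integrable μ),
        integral_add (f.integrable ν) (g.integrable ν), hf, hg]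
    · intro c f _ hf
      simp only [BoundedContinuousFunction.smul_apply]
      rw [integral_smul, integral_smul, hf]

end Orthant

variable {V Ω₁ Ω₂ : Type*} [MeasurableSpace Ω₁] [MeasurableSpace Ω₂] {U : Finset V}
  {P₁ : Measure Ω₁} {P₂ : Measure Ω₂} [IsFiniteMeasure P₁] [IsFiniteMeasure P₂]
  {X₁ : V → Ω₁ → ℝ} {X₂ : V → Ω₂ → ℝ}

/-- Uniqueness is proved on the orthant; almost sure nonnegativity lets real variables pass through
`ℝ≥0` and back without changing their law. -/
lemma map_coe_map_toNNReal {Ω : Type*} [MeasurableSpace Ω] {P : Measure Ω} {X : V → Ω → ℝ}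
    (hX : ∀ i, Measurable (X i)) (hpos : ∀ i ∈ U, ∀ᵐ ω ∂P, 0 ≤ X i ω) :
    (P.map fun ω (i : U) => (X i ω).toNNReal).map (fun x i => (x i : ℝ))
      = P.map fun ω (i : U) => X i ω := by
  rw [Measure.map_map (by fun_prop) (by fun_prop)]
  refine Measure.map_congr ?_
  have : ∀ᵐ ω ∂P, ∀ i : U, 0 ≤ X i ω := ae_all_iff.2 fun i => hpos i i.2
  filter_upwards [this] with ω hω
  ext i
  exact Real.coe_toNNReal _ (hω i)

lemma integral_map_toNNReal {Ω : Type*} [MeasurableSpace Ω] {P : Measure Ω} {X : V → Ω → ℝ}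
    (hX : ∀ i, Measurable (X i)) (hpos : ∀ i ∈ U, ∀ᵐ ω ∂P, 0 ≤ X i ω) (m : U → ℝ≥0) :
    ∫ x, Real.exp (-∑ i, (m i : ℝ) * x i) ∂(P.map fun ω (i : U) => (X i ω).toNNReal)
      = (∫⁻ ω, ENNReal.ofReal (Real.exp (-∑ i ∈ U.attach, (m i : ℝ) * X i ω)) ∂P).toReal := by
  rw [integral_map (by fun_prop) (by fun_prop : Measurable fun x : U → ℝ≥0 =>
      Real.exp (-∑ i, (m i : ℝ) * x i)).aestronglyMeasurable, integral_eq_lintegral_of_nonneg_ae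
    (ae_of_all _ fun ω => (Real.exp_pos _).le) (by fun_prop)]
  congr 1
  refine lintegral_congr_ae ?_
  have : ∀ᵐ ω ∂P, ∀ i : U, 0 ≤ X i ω := ae_all_iff.2 fun i => hpos i i.2
  filter_upwards [this] with ω hω
  congr 3
  exact Finset.sum_congr rfl fun i _ => by rw [Real.coe_toNNReal _ (hω i)]

/-- Two families of nonnegative variables with the same joint Laplace transform have the same
joint law. -/
lemma map_eq_of_laplace (h₁ : ∀ i, Measurable (X₁ i)) (h₂ : ∀ i, Measurable (X₂ i))
    (hp₁ : ∀ i ∈ U, ∀ᵐ ω ∂P₁, 0 ≤ X₁ i ω) (hp₂ : ∀ i ∈ U, ∀ᵐ ω ∂P₂, 0 ≤ X₂ i ω)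
    (h : ∀ m : V → ℝ, (∀ i, 0 ≤ m i) →
      ∫⁻ ω, ENNReal.ofReal (Real.exp (-∑ i ∈ U, m i * X₁ i ω)) ∂P₁
        = ∫⁻ ω, ENNReal.ofReal (Real.exp (-∑ i ∈ U, m i * X₂ i ω)) ∂P₂) :
    (P₁.map fun ω (i : U) => X₁ i ω) = P₂.map fun ω (i : U) => X₂ i ω := by
  classical
  rw [← map_coe_map_toNNReal h₁ hp₁, ← map_coe_map_toNNReal h₂ hp₂]
  congr 1
  refine measure_ext_of_laplace fun m => ?_
  rw [integral_map_toNNReal h₁ hp₁, integral_map_toNNReal h₂ hp₂]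
  congr 1
  have key := h (fun v => if hv : v ∈ U then (m ⟨v, hv⟩ : ℝ) else 0) fun v => by
    split_ifs
    exacts [NNReal.coe_nonneg _, le_rfl]
  have hs : ∀ x : V → ℝ, ∑ i ∈ U, (if hv : i ∈ U then (m ⟨i, hv⟩ : ℝ) else 0) * x i
      = ∑ i ∈ U.attach, (m i : ℝ) * x i := fun x => by
    rw [← Finset.sum_attach]
    exact Finset.sum_congr rfl fun i _ => by rw [dif_pos i.2]
  simp only [hs] at key
  exact key

lemma lintegral_eq_of_laplace (h₁ : ∀ i, Measurable (X₁ i)) (h₂ : ∀ i, Measurable (X₂ i))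
    (hp₁ : ∀ i ∈ U, ∀ᵐ ω ∂P₁, 0 ≤ X₁ i ω) (hp₂ : ∀ i ∈ U, ∀ᵐ ω ∂P₂, 0 ≤ X₂ i ω)
    (h : ∀ m : V → ℝ, (∀ i, 0 ≤ m i) →
      ∫⁻ ω, ENNReal.ofReal (Real.exp (-∑ i ∈ U, m i * X₁ i ω)) ∂P₁
        = ∫⁻ ω, ENNReal.ofReal (Real.exp (-∑ i ∈ U, m i * X₂ i ω)) ∂P₂)
    {Φ : (V → ℝ) → ℝ≥0∞} (hΦ : Measurable Φ)
    (hloc : ∀ b b' : V → ℝ, (∀ v ∈ U, b v = b' v) → Φ b = Φ b') :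
    ∫⁻ ω, Φ (fun v => X₁ v ω) ∂P₁ = ∫⁻ ω, Φ (fun v => X₂ v ω) ∂P₂ := by
  classical
  -- Extension by 0: since `Φ` sees only the coordinates in `U`, it factors through the finite
  -- family, whose law is known.
  set e : (U → ℝ) → V → ℝ := fun x v => if hv : v ∈ U then x ⟨v, hv⟩ else 0 with he
  have hem : Measurable e := measurable_pi_lambda _ fun v => by
    by_cases hv : v ∈ U
    · simpa only [he, dif_pos hv] using measurable_pi_apply _
    · simpa only [he, dif_neg hv] using measurable_const
  have hΦe : ∀ b : V → ℝ, Φ b = Φ (e fun i : U => b i) := fun b =>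
    hloc _ _ fun v hv => by simp only [he, dif_pos hv]
  have e₁ := lintegral_map (μ := P₁) (hΦ.comp hem) (g := fun ω (i : U) => X₁ i ω) (by fun_prop)
  have e₂ := lintegral_map (μ := P₂) (hΦ.comp hem) (g := fun ω (i : U) => X₂ i ω) (by fun_prop)
  rw [map_eq_of_laplace h₁ h₂ hp₁ hp₂ h, e₂] at e₁
  simp only [hΦe fun v => X₁ v _, hΦe fun v => X₂ v _]
  exact e₁.symm

end LaplaceUniqueness

/-! ### Dependence on the potential in `U` only, and measurability -/

section Locality

variable {V : Type*} {G : SimpleGraph V} {W : V → V → ℝ} {U : Finset V}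

instance [Countable V] (i j : V) : Countable (G.Walk i j) :=
  Function.Injective.countable (f := fun σ : G.Walk i j => σ.support)
    fun _ _ h => SimpleGraph.Walk.ext_support h

lemma greenHat_congr {b b' : V → ℝ} (h : ∀ v ∈ U, b v = b' v) (i j : V) :
    greenHat G W U b i j = greenHat G W U b' i j := by
  have : ∀ σ : PathsIn G U i j, greenTerm G W U b i j σ = greenTerm G W U b' i j σ := fun σ => by
    rw [greenTerm, greenTerm, pathPotential, pathPotential]
    congr 2
    exact List.map_congr_left fun v hv => by rw [h v (σ.2 v hv)]
  simp only [greenHat, this]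

lemma psi_congr {b b' : V → ℝ} (h : ∀ v ∈ U, b v = b' v) (i : V) :
    psi G W U b i = psi G W U b' i := by
  have : ∀ σ : ExitPaths G U i, psiTerm G W U b i σ = psiTerm G W U b' i σ := fun σ => by
    rw [psiTerm, psiTerm, pathPotentialMinus, pathPotentialMinus]
    congr 2
    exact List.map_congr_left fun v hv => by rw [h v (σ.2.2 v hv)]
  simp only [psi, this]

lemma greenForm_congr {b b' : V → ℝ} (h : ∀ v ∈ U, b v = b' v) (lam : V → ℝ) :
    greenForm G W U b lam = greenForm G W U b' lam := by
  simp only [greenForm, greenHat_congr h, psi_congr h]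

variable {Ω : Type*} {m : MeasurableSpace Ω} {β : V → Ω → ℝ}

lemma measurable_list_prod_map {s : List V} (hβ : ∀ v ∈ s, Measurable (β v)) :
    Measurable fun ω => (s.map fun v => 2 * β v ω).prod := by
  induction s with
  | nil => simp
  | cons v s ih =>
    simp only [List.map_cons, List.prod_cons]
    exact ((hβ v (by simp)).const_mul 2).mul (ih fun u hu => hβ u (by simp [hu]))

lemma measurable_greenHat [Countable V] (hβ : ∀ v ∈ U, Measurable (β v)) (i j : V) :
    Measurable fun ω => greenHat G W U (fun v => β v ω) i j := by
  simp only [greenHat]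
  split_ifs
  · exact Measurable.tsum fun σ =>
      measurable_const.div (measurable_list_prod_map fun v hv => hβ v (σ.2 v hv))
  · exact measurable_const

lemma measurable_psi [Countable V] (hβ : ∀ v ∈ U, Measurable (β v)) (i : V) :
    Measurable fun ω => psi G W U (fun v => β v ω) i := by
  simp only [psi]
  split_ifs
  · exact Measurable.tsum fun σ =>
      measurable_const.div (measurable_list_prod_map fun v hv => hβ v (σ.2.2 v hv))
  · exact measurable_const

lemma measurable_greenForm [Countable V] (hβ : ∀ v ∈ U, Measurable (β v)) (lam : V → ℝ) :
    Measurable fun ω => greenForm G W U (fun v => β v ω) lam := by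
  have h1 := fun i => measurable_psi (G := G) (W := W) hβ i
  have h2 := fun i j => measurable_greenHat (G := G) (W := W) hβ i j
  simp only [greenForm]
  fun_prop

end Locality

/-! ### Recursion for the prescribed Laplace transform -/

section LaplaceCons

variable {V : Type*} {G : SimpleGraph V} {W : V → V → ℝ} {U : Finset V} [G.LocallyFinite]

lemma betaLaplace_eq {lam : V → ℝ} (hlam : ∀ i, 0 ≤ lam i) :
    betaLaplace G W U lam
      = Real.exp (-(1 / 2 * ∑ i ∈ U, ∑ j ∈ U, edgeWeight G W i j * (√(1 + lam i) * √(1 + lam j) - 1))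
          - ∑ i ∈ U, boundaryWeight G W U i * (√(1 + lam i) - 1))
        * (1 / ∏ i ∈ U, √(1 + lam i)) := by
  classical
  rw [betaLaplace]
  congr 5
  · refine Finset.sum_congr rfl fun i _ => ?_
    rw [Finset.sum_filter]
    refine Finset.sum_congr rfl fun j _ => ?_
    rw [edgeWeight, ite_mul, zero_mul, Real.sqrt_mul (by linarith [hlam i])]
  · ext i
    rw [boundaryWeight, Finset.sum_mul]

lemma betaLaplace_pos {lam : V → ℝ} (hlam : ∀ i, 0 ≤ lam i) : 0 < betaLaplace G W U lam := by
  rw [betaLaplace]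
  have : 0 < ∏ i ∈ U, √(1 + lam i) :=
    Finset.prod_pos fun i _ => Real.sqrt_pos.2 (by linarith [hlam i])
  positivity

/-- Write t = √(1 + lam k) and s_i = √(1 + lam i). An edge from `k` to `i ∈ U` changes from a
boundary term W(s_i - 1) to an inner term W(t s_i - 1), a difference of (t - 1) W s_i. This is
linear in s_i, like the exponent in `HasGreenLaplace.laplace`, so it can be absorbed into the
parameter λ there. -/
lemma betaLaplace_cons (hsymm : ∀ i j, W i j = W j i) {k : V} (hk : k ∉ U) {lam : V → ℝ}
    (hlam : ∀ i, 0 ≤ lam i) :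
    betaLaplace G W (U.cons k hk) lam
      = Real.exp (-((√(1 + lam k) - 1) * boundaryWeight G W (U.cons k hk) k)
          - ∑ i ∈ U, (√(1 + lam k) - 1) * edgeWeight G W k i * √(1 + lam i)) / √(1 + lam k)
        * betaLaplace G W U lam := by
  have hdiv : ∀ E₁ E₂ t p : ℝ, E₁ / t * (E₂ * (1 / p)) = E₁ * E₂ * (1 / (t * p)) :=
    fun E₁ E₂ t p => by rw [one_div, one_div, mul_inv]; ring
  rw [betaLaplace_eq hlam, betaLaplace_eq hlam, Finset.prod_cons, hdiv, ← Real.exp_add]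
  congr 2
  have hb : ∑ i ∈ U, boundaryWeight G W (U.cons k hk) i * (√(1 + lam i) - 1)
      = ∑ i ∈ U, boundaryWeight G W U i * (√(1 + lam i) - 1)
        - ∑ i ∈ U, edgeWeight G W k i * (√(1 + lam i) - 1) := by
    rw [← Finset.sum_sub_distrib]
    exact Finset.sum_congr rfl fun i _ => by
      rw [boundaryWeight_cons, edgeWeight_symm hsymm i k]; ring
  have hd : ∑ i ∈ U, ∑ j ∈ U.cons k hk, edgeWeight G W i j * (√(1 + lam i) * √(1 + lam j) - 1)
      = ∑ i ∈ U, edgeWeight G W k i * (√(1 + lam k) * √(1 + lam i) - 1)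
        + ∑ i ∈ U, ∑ j ∈ U, edgeWeight G W i j * (√(1 + lam i) * √(1 + lam j) - 1) := by
    rw [← Finset.sum_add_distrib]
    exact Finset.sum_congr rfl fun i _ => by
      rw [Finset.sum_cons, edgeWeight_symm hsymm i k, mul_comm √(1 + lam i)]
  have he : ∑ i ∈ U, (√(1 + lam k) - 1) * edgeWeight G W k i * √(1 + lam i)
      = ∑ i ∈ U, edgeWeight G W k i * (√(1 + lam k) * √(1 + lam i) - 1)
        - ∑ i ∈ U, edgeWeight G W k i * (√(1 + lam i) - 1) := by
    rw [← Finset.sum_sub_distrib]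
    exact Finset.sum_congr rfl fun i _ => by ring
  rw [Finset.sum_cons, Finset.sum_cons, Finset.sum_cons, hb, hd, he, edgeWeight_self]
  ring

end LaplaceCons

/-! ### Integrating out the Schur complement at the new point -/

section Induction

open Real Set

variable {V : Type*} {G : SimpleGraph V} {W : V → V → ℝ} {U : Finset V}

lemma IsGreen.congr {b b' : V → ℝ} {X : V → V → ℝ} (hX : IsGreen G W U b X)
    (h : ∀ v ∈ U, b v = b' v) : IsGreen G W U b' X where
  pos i hi := h i hi ▸ hX.pos i hi
  left_zero := hX.left_zero
  symm := hX.symm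
  nonneg := hX.nonneg
  eqn i hi j := h i hi ▸ hX.eqn i hi j

lemma IsGreen.greenHat [G.LocallyFinite] (hsymm : ∀ i j, W i j = W j i)
    (hW : ∀ i j, G.Adj i j → 0 < W i j) {b : V → ℝ} {X : V → V → ℝ} (hX : IsGreen G W U b X) :
    IsGreen G W U b (VRJP.greenHat G W U b) := by
  have : VRJP.greenHat G W U b = X := funext₂ (hX.greenHat_eq hsymm hW)
  rwa [this]

/-- The density of the square root of the Schur complement at a new point. -/
def schurDensity (a x : ℝ) : ℝ≥0∞ := ENNReal.ofReal (√(2 / π) * exp (-(1 / 2) * (x - a / x) ^ 2))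

/-- The potential at the points of `U`, and `(x ^ 2 + schurShift) / 2` at `k`. -/
def extendedPotential [DecidableEq V] (G : SimpleGraph V) (W : V → V → ℝ) (U : Finset V) (k : V)
    (b : V → ℝ) (x : ℝ) (v : V) : ℝ :=
  if v = k then 1 / 2 * (x ^ 2 + schurShift G W U (VRJP.greenHat G W U b) k) else b v

variable [G.LocallyFinite] {k : V} (hsymm : ∀ i j, W i j = W j i)
  (hW : ∀ i j, G.Adj i j → 0 < W i j)

include hsymm hW

/-- With y = x² the whole exponent becomes -½(t² x² + (a + s)² / x²) up to terms free of x, where t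
= √(1 + μ_k), and the integral is exp(-(a + s) t) / t. After inserting `schurDrift_eq`, the
coefficients of the shift c combine as (t - 1) - ½(t² - 1) = -½(t - 1)², the quadratic term of
`greenForm_add` at r = t - 1. -/
lemma lintegral_extendedPotential [DecidableEq V] (hk : k ∉ U) {b mu lam : V → ℝ}
    (hX : IsGreen G W U b (greenHat G W U b)) (hmu : ∀ i, 0 ≤ mu i) (hlam : ∀ i, 0 ≤ lam i) :
    ∫⁻ x in Ioi (0 : ℝ), schurDensity (schurDrift G W U (greenHat G W U b) k hk) x
        * ENNReal.ofReal (exp (-∑ i ∈ U.cons k hk, mu i * extendedPotential G W U k b x i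
            - greenForm G W (U.cons k hk) (extendedPotential G W U k b x) lam))
      = ENNReal.ofReal (exp (-((√(1 + mu k) - 1) * boundaryWeight G W (U.cons k hk) k)
            - lam k * √(1 + mu k)) / √(1 + mu k))
        * ENNReal.ofReal (exp (-∑ i ∈ U, mu i * b i
            - greenForm G W U b fun i => lam i + (√(1 + mu k) - 1) * edgeWeight G W k i)) := by
  set t := √(1 + mu k) with ht
  have ht0 : 0 < t := Real.sqrt_pos.2 (by linarith [hmu k])
  have ht2 : t ^ 2 = 1 + mu k := Real.sq_sqrt (by linarith [hmu k])
  have hmuk : mu k = t ^ 2 - 1 := by linarith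
  set X := greenHat G W U b
  set c := schurShift G W U X k with hc
  have ha := hX.schurDrift_nonneg hW hk
  have haeq := hX.schurDrift_eq hsymm hW hk
  set a := schurDrift G W U X k hk
  set s := lam k + ∑ i ∈ U, lam i * hitting G W U X k i with hs
  have hs0 : 0 ≤ s := add_nonneg (hlam k)
    (Finset.sum_nonneg fun i _ => mul_nonneg (hlam i) (hX.hitting_nonneg hW i))
  -- All factors independent of x; the summand `+ a` is the cross term of (x - a / x)² in the
  -- density.
  set A := exp (-∑ i ∈ U, mu i * b i - 1 / 2 * mu k * c
    - (greenForm G W U b lam - ∑ i ∈ U, lam i * hitting G W U X k i) + a) with hA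
  have hEk : ∀ x, extendedPotential G W U k b x k = 1 / 2 * (x ^ 2 + c) := fun x => if_pos rfl
  have hE : ∀ x, ∀ v ∈ U, b v = extendedPotential G W U k b x v := fun x v hv =>
    (if_neg fun h : v = k => hk (h ▸ hv)).symm
  have hint : ∀ x ∈ Ioi (0 : ℝ), schurDensity a x
        * ENNReal.ofReal (exp (-∑ i ∈ U.cons k hk, mu i * extendedPotential G W U k b x i
            - greenForm G W (U.cons k hk) (extendedPotential G W U k b x) lam))
      = ENNReal.ofReal A
        * ENNReal.ofReal (√(2 / π) * exp (-(1 / 2) * (t ^ 2 * x ^ 2 + (a + s) ^ 2 / x ^ 2))) := by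
    intro x hx
    have hx0 : (0 : ℝ) < x := hx
    have hX' := hX.congr (hE x)
    have hy : 2 * extendedPotential G W U k b x k - schurShift G W U X k = x ^ 2 := by
      rw [hEk]; ring
    have hform := hX'.greenForm_cons hsymm hW hk (by rw [hy]; positivity) lam
    rw [hy, ← greenForm_congr (hE x)] at hform
    have hsum : ∑ i ∈ U, mu i * extendedPotential G W U k b x i = ∑ i ∈ U, mu i * b i :=
      Finset.sum_congr rfl fun i hi => by rw [hE x i hi]
    rw [schurDensity, ← ENNReal.ofReal_mul (by positivity), ← ENNReal.ofReal_mul (by positivity),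
      Finset.sum_cons, hsum, hEk, hform, hA, mul_assoc, mul_left_comm (exp _), ← exp_add,
      ← exp_add, ← hs, hmuk]
    congr 3
    field_simp
    ring
  rw [setLIntegral_congr_fun measurableSet_Ioi hint, lintegral_const_mul _ (by fun_prop),
    lintegral_exp_neg_sq_add_inv_sq ht0 (add_nonneg ha hs0), ← ENNReal.ofReal_mul (by positivity),
    ← ENNReal.ofReal_mul (by positivity), hX.greenForm_add hsymm hW, hA, ← mul_div_assoc,
    ← exp_add, div_mul_eq_mul_div (exp _) t (exp _), ← exp_add, haeq, hs, hmuk]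
  congr 3
  ring

end Induction

/-! ### Joint Laplace transform of β, ψ and Ĝ, by induction on the finite set -/

section JointLaw

open Real Set

variable {V : Type*} {G : SimpleGraph V} {W : V → V → ℝ} {U : Finset V} {k : V}

lemma measurable_schurShift [Countable V] {Ω : Type*} {m : MeasurableSpace Ω} {β : V → Ω → ℝ}
    (hβ : ∀ v, Measurable (β v)) :
    Measurable fun ω => schurShift G W U (greenHat G W U fun v => β v ω) k := by
  have h := fun i j => measurable_greenHat (G := G) (W := W) (U := U) (fun v _ => hβ v) i j
  simp only [schurShift, hitting]
  fun_prop

variable [G.LocallyFinite]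

lemma measurable_schurDrift [Countable V] {Ω : Type*} {m : MeasurableSpace Ω} {β : V → Ω → ℝ}
    (hβ : ∀ v, Measurable (β v)) (hk : k ∉ U) :
    Measurable fun ω => schurDrift G W U (greenHat G W U fun v => β v ω) k hk := by
  have h := fun i j => measurable_greenHat (G := G) (W := W) (U := U) (fun v _ => hβ v) i j
  simp only [schurDrift, hitting]
  fun_prop

variable {Ω : Type*} [MeasurableSpace Ω] {P : Measure Ω} {β : V → Ω → ℝ}

variable (G W U P β) in
/-- The Green function of `2β - W` on `U` is almost surely well defined, and its joint law with `β`
and `ψ` has the expected Laplace transform. -/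
structure HasGreenLaplace : Prop where
  isGreen : ∀ᵐ ω ∂P, IsGreen G W U (fun v => β v ω) (greenHat G W U fun v => β v ω)
  laplace : ∀ mu lam : V → ℝ, (∀ i, 0 ≤ mu i) → (∀ i, 0 ≤ lam i) →
    ∫⁻ ω, ENNReal.ofReal (exp (-∑ i ∈ U, mu i * β i ω
        - greenForm G W U (fun v => β v ω) lam)) ∂P
      = ENNReal.ofReal (exp (-∑ i ∈ U, lam i * √(1 + mu i)) * betaLaplace G W U mu)

lemma hasGreenLaplace_empty [IsProbabilityMeasure P] : HasGreenLaplace G W ∅ P β where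
  isGreen := ae_of_all _ fun ω => by
    have h0 : ∀ i j, greenHat G W ∅ (fun v => β v ω) i j = 0 := fun i j => by simp [greenHat]
    exact ⟨by simp, fun i j _ => h0 i j, fun i j => by rw [h0, h0], fun i j => (h0 i j).ge,
      by simp⟩
  laplace mu lam _ _ := by simp [greenForm, betaLaplace]

lemma IsBetaField.lintegral (hβ : IsBetaField G W P β) (U : Finset V)
    {mu : V → ℝ} (hmu : ∀ i, 0 ≤ mu i) :
    ∫⁻ ω, ENNReal.ofReal (exp (-∑ i ∈ U, mu i * β i ω)) ∂P
      = ENNReal.ofReal (betaLaplace G W U mu) := by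
  have h := hβ.laplace U mu fun i _ => hmu i
  -- A non-integrable function would have Bochner integral 0, but the prescribed transform is
  -- positive.
  have hint : Integrable (fun ω => exp (-∑ i ∈ U, mu i * β i ω)) P := by
    by_contra hn
    rw [integral_undef hn] at h
    exact (betaLaplace_pos hmu).ne h
  rw [← ofReal_integral_eq_lintegral_ofReal hint (ae_of_all _ fun ω => (exp_pos _).le), h]

variable (G W U P β) in
/-- The law of `β` on `Ω` together with the square root of the Schur complement at `k`. -/
def schurMeasure (hk : k ∉ U) : Measure (Ω × ℝ) :=
  (P.prod (volume.restrict (Ioi 0))).withDensity fun p =>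
    schurDensity (schurDrift G W U (greenHat G W U fun v => β v p.1) k hk) p.2

omit [G.LocallyFinite] in
lemma measurable_extendedPotential [Countable V] [DecidableEq V] (hβ : ∀ v, Measurable (β v))
    (v : V) :
    Measurable fun p : Ω × ℝ => extendedPotential G W U k (fun v => β v p.1) p.2 v := by
  have h : Measurable fun p : Ω × ℝ => schurShift G W U (greenHat G W U fun v => β v p.1) k :=
    (measurable_schurShift hβ).comp measurable_fst
  have := hβ v
  simp only [extendedPotential]
  split_ifs <;> fun_prop

lemma ae_schurMeasure_of_ae (hk : k ∉ U) {p : Ω → Prop}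
    (h : ∀ᵐ ω ∂P, p ω) :
    ∀ᵐ q ∂(schurMeasure G W U P β hk), p q.1 ∧ 0 < q.2 := by
  refine (withDensity_absolutelyContinuous _ _).ae_le ?_
  have h1 := Measure.quasiMeasurePreserving_fst (μ := P) (ν := volume.restrict (Ioi (0 : ℝ))) |>.ae h
  have h2 := Measure.quasiMeasurePreserving_snd (μ := P) (ν := volume.restrict (Ioi (0 : ℝ))) |>.ae
    (ae_restrict_mem measurableSet_Ioi)
  filter_upwards [h1, h2] with q hq1 hq2 using ⟨hq1, hq2⟩

variable (hsymm : ∀ i j, W i j = W j i) (hW : ∀ i j, G.Adj i j → 0 < W i j)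

include hsymm hW

/-- Integrate the last coordinate first; what remains is the transform on `U` at a shifted λ, known
by hypothesis, and `betaLaplace_cons` reassembles the factors. -/
lemma HasGreenLaplace.lintegral_schurMeasure [Countable V] [DecidableEq V]
    (hU : HasGreenLaplace G W U P β) (hβ : ∀ v, Measurable (β v)) (hk : k ∉ U) {mu lam : V → ℝ}
    (hmu : ∀ i, 0 ≤ mu i) (hlam : ∀ i, 0 ≤ lam i) :
    ∫⁻ p, ENNReal.ofReal (exp (-∑ i ∈ U.cons k hk,
            mu i * extendedPotential G W U k (fun v => β v p.1) p.2 i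
          - greenForm G W (U.cons k hk) (extendedPotential G W U k (fun v => β v p.1) p.2) lam))
        ∂(schurMeasure G W U P β hk)
      = ENNReal.ofReal (exp (-∑ i ∈ U.cons k hk, lam i * √(1 + mu i))
          * betaLaplace G W (U.cons k hk) mu) := by
  have hm := measurable_extendedPotential (G := G) (W := W) (U := U) (k := k) hβ
  have hf := measurable_greenForm (G := G) (W := W) (U := U.cons k hk)
    (β := fun v (p : Ω × ℝ) => extendedPotential G W U k (fun v => β v p.1) p.2 v)
    (fun v _ => hm v) lam
  have hdr : Measurable fun p : Ω × ℝ =>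
      schurDrift G W U (greenHat G W U fun v => β v p.1) k hk :=
    (measurable_schurDrift hβ hk).comp measurable_fst
  have hd : Measurable fun p : Ω × ℝ =>
      schurDensity (schurDrift G W U (greenHat G W U fun v => β v p.1) k hk) p.2 := by
    simp only [schurDensity]
    fun_prop
  have hint : Measurable fun p : Ω × ℝ => ENNReal.ofReal (exp (-∑ i ∈ U.cons k hk,
            mu i * extendedPotential G W U k (fun v => β v p.1) p.2 i
          - greenForm G W (U.cons k hk) (extendedPotential G W U k (fun v => β v p.1) p.2) lam)) := by
    fun_prop
  have ht : 1 ≤ √(1 + mu k) := Real.one_le_sqrt.2 (by linarith [hmu k])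
  -- The shifted parameter stays nonnegative, as the transform on `U` requires; this is where `√(1 +
  -- mu k) ≥ 1` enters.
  have hlam' : ∀ i, 0 ≤ lam i + (√(1 + mu k) - 1) * edgeWeight G W k i := fun i =>
    add_nonneg (hlam i) (mul_nonneg (by linarith) (edgeWeight_nonneg hW k i))
  have hinner : ∀ᵐ ω ∂P, ∫⁻ x in Ioi (0 : ℝ),
        schurDensity (schurDrift G W U (greenHat G W U fun v => β v ω) k hk) x
        * ENNReal.ofReal (exp (-∑ i ∈ U.cons k hk,
            mu i * extendedPotential G W U k (fun v => β v ω) x i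
          - greenForm G W (U.cons k hk) (extendedPotential G W U k (fun v => β v ω) x) lam))
      = ENNReal.ofReal (exp (-((√(1 + mu k) - 1) * boundaryWeight G W (U.cons k hk) k)
            - lam k * √(1 + mu k)) / √(1 + mu k))
        * ENNReal.ofReal (exp (-∑ i ∈ U, mu i * β i ω - greenForm G W U (fun v => β v ω)
            fun i => lam i + (√(1 + mu k) - 1) * edgeWeight G W k i)) := by
    filter_upwards [hU.isGreen] with ω hω
    exact lintegral_extendedPotential hsymm hW hk hω hmu hlam
  rw [schurMeasure, lintegral_withDensity_eq_lintegral_mul _ hd hint,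
    lintegral_prod _ (hd.mul hint).aemeasurable]
  simp only [Pi.mul_apply]
  rw [lintegral_congr_ae hinner, lintegral_const_mul' _ _ ENNReal.ofReal_ne_top,
    hU.laplace mu _ hmu hlam', ← ENNReal.ofReal_mul (by positivity), betaLaplace_cons hsymm hk hmu,
    ← mul_assoc, ← mul_assoc, div_mul_eq_mul_div, ← exp_add, ← mul_div_assoc, ← exp_add,
    Finset.sum_cons]
  congr 4
  simp only [add_mul, Finset.sum_add_distrib]
  ring

/-- The joint law of the potential on `U` and at `k` is that of the extended potential. -/
lemma HasGreenLaplace.lintegral_eq [Countable V] [DecidableEq V] [IsProbabilityMeasure P]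
    (hβ : IsBetaField G W P β) (hU : HasGreenLaplace G W U P β) (hk : k ∉ U)
    {Φ : (V → ℝ) → ℝ≥0∞} (hΦ : Measurable Φ)
    (hloc : ∀ b b' : V → ℝ, (∀ v ∈ U.cons k hk, b v = b' v) → Φ b = Φ b') :
    ∫⁻ ω, Φ (fun v => β v ω) ∂P
      = ∫⁻ p, Φ (extendedPotential G W U k (fun v => β v p.1) p.2)
          ∂(schurMeasure G W U P β hk) := by
  set X : V → Ω × ℝ → ℝ :=
    fun v p => extendedPotential G W U k (fun v => β v p.1) p.2 v with hXdef
  have hXm : ∀ v, Measurable (X v) := measurable_extendedPotential hβ.measurable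
  have hlap := fun mu lam => hU.lintegral_schurMeasure hsymm hW hβ.measurable hk
    (mu := mu) (lam := lam)
  have hform0 : ∀ b : V → ℝ, greenForm G W (U.cons k hk) b (fun _ => 0) = 0 := fun b => by
    simp [greenForm]
  -- At λ = 0 the computed transform is the prescribed one on `U ∪ {k}`, so the law can be
  -- identified before anything is known about the Green function there.
  have hL : ∀ mu : V → ℝ, (∀ i, 0 ≤ mu i) →
      ∫⁻ ω, ENNReal.ofReal (exp (-∑ i ∈ U.cons k hk, mu i * β i ω)) ∂P
        = ∫⁻ p, ENNReal.ofReal (exp (-∑ i ∈ U.cons k hk, mu i * X i p))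
            ∂(schurMeasure G W U P β hk) := fun mu hmu => by
    have := hlap mu (fun _ => 0) hmu fun _ => le_rfl
    simp only [hform0, sub_zero, zero_mul, Finset.sum_const_zero, neg_zero, exp_zero,
      one_mul] at this
    rw [hβ.lintegral _ hmu, ← this]
  have hfin : IsFiniteMeasure (schurMeasure G W U P β hk) := ⟨by
    have := hL (fun _ => 0) fun _ => le_rfl
    simp only [zero_mul, Finset.sum_const_zero, neg_zero, exp_zero, ENNReal.ofReal_one,
      lintegral_const, measure_univ, mul_one, one_mul] at this
    rw [← this]
    exact ENNReal.one_lt_top⟩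
  have hpos₁ : ∀ i ∈ U.cons k hk, ∀ᵐ ω ∂P, 0 ≤ β i ω := fun i _ =>
    (hβ.pos i).mono fun ω h => h.le
  have hpos₂ : ∀ i ∈ U.cons k hk, ∀ᵐ p ∂(schurMeasure G W U P β hk), 0 ≤ X i p := by
    intro i _
    filter_upwards [ae_schurMeasure_of_ae hk (hU.isGreen.and (hβ.pos i))] with p hp
    simp only [hXdef, extendedPotential]
    split_ifs
    · have := hp.1.1.schurShift_nonneg hW (k := k)
      positivity
    · exact hp.1.2.le
  exact lintegral_eq_of_laplace hβ.measurable hXm hpos₁ hpos₂ hL hΦ hloc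

/-- For the extended potential the Schur complement is x² with x > 0. Its positivity depends on the
potential in `U ∪ {k}` only, so it transfers to β by equality of laws. -/
lemma HasGreenLaplace.ae_schurShift_lt [Countable V] [IsProbabilityMeasure P]
    (hβ : IsBetaField G W P β) (hU : HasGreenLaplace G W U P β) (hk : k ∉ U) :
    ∀ᵐ ω ∂P, 0 < 2 * β k ω - schurShift G W U (greenHat G W U fun v => β v ω) k := by
  classical
  set B : Set (V → ℝ) := {b | 2 * b k - schurShift G W U (greenHat G W U b) k ≤ 0} with hB
  have hBm : MeasurableSet B := by
    have := measurable_schurShift (G := G) (W := W) (U := U) (k := k)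
      (β := fun v (b : V → ℝ) => b v) (fun v => measurable_pi_apply v)
    exact measurableSet_le (by fun_prop) measurable_const
  have h1 := hU.lintegral_eq hsymm hW hβ hk (Φ := B.indicator fun _ => 1) (measurable_const.indicator hBm) (by
    intro b b' hbb
    have hg : greenHat G W U b = greenHat G W U b' :=
      funext₂ (greenHat_congr fun v hv => hbb v (Finset.mem_cons_of_mem hv))
    have : b ∈ B ↔ b' ∈ B := by
      simp only [hB, mem_ofPred_eq, hg, hbb k (Finset.mem_cons_self k U)]
    simp only [indicator_apply, this])
  have h2 : ∫⁻ p, B.indicator (fun _ => (1 : ℝ≥0∞)) (extendedPotential G W U k (fun v => β v p.1) p.2)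
      ∂(schurMeasure G W U P β hk) = 0 := by
    rw [← lintegral_zero (μ := schurMeasure G W U P β hk)]
    refine lintegral_congr_ae ?_
    filter_upwards [ae_schurMeasure_of_ae hk (Filter.Eventually.of_forall fun _ => trivial)]
      with p hp
    refine indicator_of_notMem (fun h => ?_) _
    have hg : greenHat G W U (extendedPotential G W U k (fun v => β v p.1) p.2)
        = greenHat G W U fun v => β v p.1 :=
      funext₂ (greenHat_congr fun v hv => if_neg fun h : v = k => hk (h ▸ hv))
    have hk' : extendedPotential G W U k (fun v => β v p.1) p.2 k
        = 1 / 2 * (p.2 ^ 2 + schurShift G W U (greenHat G W U fun v => β v p.1) k) := if_pos rfl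
    simp only [hB, mem_ofPred_eq, hg, hk'] at h
    have := pow_pos hp.2 2
    linarith
  rw [h2, lintegral_eq_zero_iff (by
    exact (measurable_const.indicator hBm).comp (measurable_pi_lambda _ hβ.measurable))] at h1
  filter_upwards [h1] with ω hω
  by_contra hn
  have : (fun v => β v ω) ∈ B := not_lt.1 hn
  simp [indicator_of_mem this] at hω

lemma HasGreenLaplace.cons [Countable V] [IsProbabilityMeasure P]
    (hβ : IsBetaField G W P β) (hU : HasGreenLaplace G W U P β) (hk : k ∉ U) :
    HasGreenLaplace G W (U.cons k hk) P β := by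
  classical
  refine ⟨?_, fun mu lam hmu hlam => ?_⟩
  · filter_upwards [hU.isGreen, hU.ae_schurShift_lt hsymm hW hβ hk] with ω h1 h2
    exact (h1.cons hsymm hW hk h2).greenHat hsymm hW
  · rw [← hU.lintegral_schurMeasure hsymm hW hβ.measurable hk hmu hlam]
    refine hU.lintegral_eq hsymm hW hβ hk (Φ := fun b => ENNReal.ofReal (exp (-∑ i ∈ U.cons k hk, mu i * b i
      - greenForm G W (U.cons k hk) b lam))) ?_ ?_
    · have := measurable_greenForm (G := G) (W := W) (U := U.cons k hk)
        (β := fun v (b : V → ℝ) => b v) (fun v _ => measurable_pi_apply v) lam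
      fun_prop
    · intro b b' hbb
      rw [greenForm_congr hbb, Finset.sum_congr rfl fun i hi => by rw [hbb i hi]]

theorem IsBetaField.hasGreenLaplace [Countable V] [IsProbabilityMeasure P]
    (hβ : IsBetaField G W P β) (U : Finset V) : HasGreenLaplace G W U P β := by
  induction U using Finset.cons_induction with
  | empty => exact hasGreenLaplace_empty
  | cons k U hk ih => exact ih.cons hsymm hW hβ hk

end JointLaw

/-! ### Finite moments of β, Ĝ and ψ -/

section Moments

open Real Set
open scoped NNReal

section AllMoments

variable {Ω : Type*} [MeasurableSpace Ω] {P : Measure Ω} {f g : Ω → ℝ}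

/-- The random variable `f` has finite moments of all orders. -/
def AllMoments (f : Ω → ℝ) (P : Measure Ω) : Prop := ∀ p : ℝ≥0, MemLp f p P

lemma AllMoments.const_mul (hf : AllMoments f P) (c : ℝ) : AllMoments (fun ω => c * f ω) P :=
  fun p => (hf p).const_mul c

lemma AllMoments.mul (hf : AllMoments f P) (hg : AllMoments g P) :
    AllMoments (fun ω => f ω * g ω) P := fun p => by
  have : ENNReal.HolderTriple ((2 * p : ℝ≥0) : ℝ≥0∞) ((2 * p : ℝ≥0) : ℝ≥0∞) (p : ℝ≥0∞) := ⟨by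
    rw [← two_mul, ENNReal.coe_mul, ENNReal.coe_ofNat,
      ENNReal.mul_inv (Or.inl two_ne_zero) (Or.inl ENNReal.ofNat_ne_top), ← mul_assoc,
      ENNReal.mul_inv_cancel two_ne_zero ENNReal.ofNat_ne_top, one_mul]⟩
  exact MemLp.mul (hg (2 * p)) (hf (2 * p))

lemma AllMoments.mono (hg : AllMoments g P) (hf : Measurable f)
    (h : ∀ᵐ ω ∂P, 0 ≤ f ω ∧ f ω ≤ g ω) : AllMoments f P := fun p =>
  (hg p).mono hf.aestronglyMeasurable <| by
    filter_upwards [h] with ω hω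
    rw [norm_of_nonneg hω.1]
    exact hω.2.trans (le_abs_self _)

lemma AllMoments.sum {ι : Type*} (s : Finset ι) {F : ι → Ω → ℝ}
    (hF : ∀ i ∈ s, AllMoments (F i) P) : AllMoments (fun ω => ∑ i ∈ s, F i ω) P := fun p =>
  memLp_finsetSum s fun i hi => hF i hi p

lemma allMoments_const [IsFiniteMeasure P] (c : ℝ) : AllMoments (fun _ => c) P := fun _ =>
  memLp_const c

lemma AllMoments.congr (hf : AllMoments f P) (h : f =ᵐ[P] g) : AllMoments g P := fun p =>
  (hf p).ae_eq h

lemma AllMoments.add (hf : AllMoments f P) (hg : AllMoments g P) :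
    AllMoments (fun ω => f ω + g ω) P := fun p => (hf p).add (hg p)

lemma AllMoments.integrable (hf : AllMoments f P) : Integrable f P :=
  memLp_one_iff_integrable.1 (hf 1)

end AllMoments

variable {V : Type*} [Countable V] {G : SimpleGraph V} {W : V → V → ℝ} {U : Finset V}
  [G.LocallyFinite] {Ω : Type*} [MeasurableSpace Ω] {P : Measure Ω} [IsProbabilityMeasure P]
  {β : V → Ω → ℝ} (hsymm : ∀ i j, W i j = W j i) (hW : ∀ i j, G.Adj i j → 0 < W i j)
  (hβ : IsBetaField G W P β)

include hsymm hW hβ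

/-- For `U = ∅` the Schur complement is 2β_k itself, so its law is explicit. -/
lemma IsBetaField.lintegral_exp_half_ne_top (k : V) :
    ∫⁻ ω, ENNReal.ofReal (exp (1 / 2 * β k ω)) ∂P ≠ ∞ := by
  classical
  have hk : k ∉ (∅ : Finset V) := Finset.notMem_empty k
  have h := (hasGreenLaplace_empty (G := G) (W := W)).lintegral_eq hsymm hW hβ hk
    (Φ := fun b => ENNReal.ofReal (exp (1 / 2 * b k))) (by fun_prop)
    fun b b' hb => by rw [hb k (Finset.mem_cons_self k ∅)]
  rw [h]
  have hdr : ∀ ω, schurDrift G W ∅ (greenHat G W ∅ fun v => β v ω) k hk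
      = boundaryWeight G W (Finset.cons k ∅ hk) k := fun ω => by simp [schurDrift]
  have hext : ∀ p : Ω × ℝ, extendedPotential G W ∅ k (fun v => β v p.1) p.2 k
      = 1 / 2 * p.2 ^ 2 := fun p => by simp [extendedPotential, schurShift]
  set a := boundaryWeight G W (Finset.cons k ∅ hk) k with ha
  have ha0 : 0 ≤ a := boundaryWeight_nonneg hW k
  simp only [schurMeasure, hdr, hext]
  have hd : Measurable fun p : Ω × ℝ => schurDensity a p.2 := by
    simp only [schurDensity]
    fun_prop
  rw [lintegral_withDensity_eq_lintegral_mul _ hd (by fun_prop),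
    lintegral_prod _ (hd.mul (by fun_prop)).aemeasurable]
  simp only [Pi.mul_apply, lintegral_const, measure_univ, mul_one]
  -- With β_k = x² / 2 the factor exp(β_k / 2) = exp(x² / 4) halves the Gaussian rate of the
  -- density, so t² = 1 / 2.
  have ht : (0 : ℝ) < √(1 / 2) := Real.sqrt_pos.2 (by norm_num)
  have hint : ∀ x ∈ Ioi (0 : ℝ), schurDensity a x * ENNReal.ofReal (exp (1 / 2 * (1 / 2 * x ^ 2)))
      = ENNReal.ofReal (exp a) * ENNReal.ofReal
        (√(2 / π) * exp (-(1 / 2) * (√(1 / 2) ^ 2 * x ^ 2 + a ^ 2 / x ^ 2))) := fun x hx => by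
    have hx0 : x ≠ 0 := ne_of_gt hx
    rw [schurDensity, ← ENNReal.ofReal_mul (by positivity), ← ENNReal.ofReal_mul (by positivity),
      mul_assoc, mul_left_comm (exp a), ← exp_add, ← exp_add, Real.sq_sqrt (by norm_num)]
    congr 3
    field_simp
    ring
  rw [setLIntegral_congr_fun measurableSet_Ioi hint, lintegral_const_mul _ (by fun_prop),
    lintegral_exp_neg_sq_add_inv_sq ht ha0]
  exact ENNReal.mul_ne_top ENNReal.ofReal_ne_top ENNReal.ofReal_ne_top

lemma IsBetaField.allMoments (k : V) : AllMoments (β k) P := by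
  have hm := hβ.measurable k
  have h1 : Integrable (fun ω => exp (1 / 2 * β k ω)) P :=
    (lintegral_ofReal_ne_top_iff_integrable (by fun_prop)
      (ae_of_all _ fun ω => (exp_pos _).le)).1 (hβ.lintegral_exp_half_ne_top hsymm hW k)
  refine fun p => memLp_of_mem_interior_integrableExpSet ?_ p
  refine interior_mono (s := Iio (1 / 2 : ℝ)) (fun t ht => ?_) ?_
  · refine h1.mono (by fun_prop) ?_
    filter_upwards [hβ.pos k] with ω hω
    rw [norm_of_nonneg (exp_pos _).le, norm_of_nonneg (exp_pos _).le, exp_le_exp]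
    exact mul_le_mul_of_nonneg_right (le_of_lt ht) hω.le
  · rw [isOpen_Iio.interior_eq]
    norm_num

omit [G.LocallyFinite] hsymm hW hβ in
lemma measurable_hitting (hβ : ∀ v, Measurable (β v)) (k i : V) :
    Measurable fun ω => hitting G W U (greenHat G W U fun v => β v ω) k i := by
  have h := fun i j => measurable_greenHat (G := G) (W := W) (U := U) (fun v _ => hβ v) i j
  simp only [hitting]
  fun_prop

/-- W_{o,l} times the hitting value at `l` is one nonnegative term of the Schur shift at `o`, which
is almost surely below 2β_o. -/
lemma allMoments_hitting_of_adj {o l : V} (ho : o ∉ U) (hl : l ∈ U) (hol : G.Adj o l) :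
    AllMoments (fun ω => hitting G W U (greenHat G W U fun v => β v ω) o l) P := by
  have hU := hβ.hasGreenLaplace hsymm hW U
  have hw := hW o l hol
  refine ((hβ.allMoments hsymm hW o).const_mul (2 / W o l)).mono
    (measurable_hitting hβ.measurable o l) ?_
  filter_upwards [hU.isGreen, hU.ae_schurShift_lt hsymm hW hβ ho] with ω h1 h2
  refine ⟨h1.hitting_nonneg hW l, ?_⟩
  have h3 : edgeWeight G W o l * hitting G W U (greenHat G W U fun v => β v ω) o l
      ≤ schurShift G W U (greenHat G W U fun v => β v ω) o :=
    Finset.single_le_sum (f := fun i => edgeWeight G W o i *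
      hitting G W U (greenHat G W U fun v => β v ω) o i)
      (fun i _ => mul_nonneg (edgeWeight_nonneg hW o i) (h1.hitting_nonneg hW i)) hl
  rw [edgeWeight_of_adj hol] at h3
  rw [div_mul_eq_mul_div, le_div_iff₀ hw]
  linarith

/-- In the Green equation at `l`, the term of the neighbour `j` is at most 2β_l times the hitting
value at `l`. -/
lemma AllMoments.hitting_of_adj {o l j : V} (hl : l ∈ U) (hlj : G.Adj l j) (hj : j ∈ U)
    (h : AllMoments (fun ω => hitting G W U (greenHat G W U fun v => β v ω) o l) P) :
    AllMoments (fun ω => hitting G W U (greenHat G W U fun v => β v ω) o j) P := by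
  have hU := hβ.hasGreenLaplace hsymm hW U
  have hw := hW l j hlj
  refine (((hβ.allMoments hsymm hW l).mul h).const_mul (2 / W l j)).mono
    (measurable_hitting hβ.measurable o j) ?_
  filter_upwards [hU.isGreen] with ω h1
  refine ⟨h1.hitting_nonneg hW j, ?_⟩
  have h3 : edgeWeight G W l j * hitting G W U (greenHat G W U fun v => β v ω) o j
      ≤ ∑ i ∈ U, edgeWeight G W l i * hitting G W U (greenHat G W U fun v => β v ω) o i :=
    Finset.single_le_sum (f := fun i => edgeWeight G W l i *
      hitting G W U (greenHat G W U fun v => β v ω) o i)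
      (fun i _ => mul_nonneg (edgeWeight_nonneg hW l i) (h1.hitting_nonneg hW i)) hj
  have h4 := h1.eqn_hitting (k := o) hl
  have h5 := edgeWeight_nonneg hW (G := G) l o
  rw [edgeWeight_of_adj hlj] at h3
  rw [div_mul_eq_mul_div, le_div_iff₀ hw]
  linarith

lemma AllMoments.hitting_of_walk {o l j : V} (σ : G.Walk l j) (hσ : ∀ v ∈ σ.support, v ∈ U)
    (h : AllMoments (fun ω => hitting G W U (greenHat G W U fun v => β v ω) o l) P) :
    AllMoments (fun ω => hitting G W U (greenHat G W U fun v => β v ω) o j) P := by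
  induction σ with
  | nil => exact h
  | cons hadj p ih =>
    simp only [SimpleGraph.Walk.support_cons, List.forall_mem_cons] at hσ
    exact ih hσ.2 (h.hitting_of_adj hsymm hW hβ hσ.1 hadj (hσ.2 _ p.start_mem_support))

/-- Ĝ(i,v) W_{v,o} is one term of the hitting value at `i`, whose moments are carried from `v` to
`i` along a path inside `U`. Without such a path Ĝ(v,i) is an empty sum. -/
lemma allMoments_greenHat_of_adj {o v : V} (ho : o ∉ U) (hv : v ∈ U) (hov : G.Adj o v) (i : V) :
    AllMoments (fun ω => greenHat G W U (fun v => β v ω) v i) P := by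
  by_cases hpath : Nonempty (PathsIn G U v i)
  · obtain ⟨σ, hσ⟩ := hpath
    have hU := hβ.hasGreenLaplace hsymm hW U
    have hw := hW o v hov
    have hh := (allMoments_hitting_of_adj hsymm hW hβ ho hv hov).hitting_of_walk hsymm hW hβ σ hσ
    refine (hh.const_mul (1 / W o v)).mono (measurable_greenHat (fun v _ => hβ.measurable v) v i) ?_
    filter_upwards [hU.isGreen] with ω h1
    refine ⟨h1.nonneg v i, ?_⟩
    have h3 : greenHat G W U (fun v => β v ω) i v * edgeWeight G W v o
        ≤ hitting G W U (greenHat G W U fun v => β v ω) o i :=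
      Finset.single_le_sum (f := fun j => greenHat G W U (fun v => β v ω) i j * edgeWeight G W j o)
        (fun j _ => mul_nonneg (h1.nonneg i j) (edgeWeight_nonneg hW j o)) hv
    rw [edgeWeight_of_adj hov.symm, hsymm v o, h1.symm] at h3
    rw [div_mul_eq_mul_div, le_div_iff₀ hw]
    linarith
  · have : ∀ ω, greenHat G W U (fun v => β v ω) v i = 0 := fun ω => by
      rw [greenHat]
      have := not_nonempty_iff.1 hpath
      split_ifs <;> simp
    simp only [this]
    exact allMoments_const 0

lemma AllMoments.greenHat_of_adj {v v' : V} (hv : v ∈ U) (hv' : v' ∈ U) (hadj : G.Adj v v') (i : V)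
    (h : AllMoments (fun ω => greenHat G W U (fun v => β v ω) v i) P) :
    AllMoments (fun ω => greenHat G W U (fun v => β v ω) v' i) P := by
  classical
  have hU := hβ.hasGreenLaplace hsymm hW U
  have hw := hW v v' hadj
  refine (((hβ.allMoments hsymm hW v).mul h).const_mul (2 / W v v')).mono
    (measurable_greenHat (fun v _ => hβ.measurable v) v' i) ?_
  filter_upwards [hU.isGreen] with ω h1
  refine ⟨h1.nonneg v' i, ?_⟩
  have h3 : edgeWeight G W v v' * greenHat G W U (fun v => β v ω) v' i
      ≤ ∑ l ∈ U, edgeWeight G W v l * greenHat G W U (fun v => β v ω) l i :=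
    Finset.single_le_sum (f := fun l => edgeWeight G W v l * greenHat G W U (fun v => β v ω) l i)
      (fun l _ => mul_nonneg (edgeWeight_nonneg hW v l) (h1.nonneg l i)) hv'
  have h4 := h1.eqn v hv i
  have h5 : (0 : ℝ) ≤ if v = i then 1 else 0 := by split_ifs <;> norm_num
  rw [edgeWeight_of_adj hadj] at h3
  rw [div_mul_eq_mul_div, le_div_iff₀ hw]
  linarith

/-- The walk may leave `U` and come back: a step inside `U` propagates the bound through the Green
equation, and a step entering `U` from outside provides it afresh. The assumption at `o` is
conditional so that the walk can start outside `U`. -/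
lemma allMoments_greenHat_of_walk {o v : V} (σ : G.Walk o v) (i : V)
    (h : o ∈ U → AllMoments (fun ω => greenHat G W U (fun v => β v ω) o i) P) (hv : v ∈ U) :
    AllMoments (fun ω => greenHat G W U (fun v => β v ω) v i) P := by
  induction σ with
  | nil => exact h hv
  | @cons a c _ hadj p ih =>
    refine ih (fun hc => ?_) hv
    by_cases ha : a ∈ U
    · exact (h ha).greenHat_of_adj hsymm hW hβ ha hc hadj i
    · exact allMoments_greenHat_of_adj hsymm hW hβ ha hc hadj i

theorem IsBetaField.allMoments_greenHat [Infinite V] (hG : G.Connected) (i j : V) :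
    AllMoments (fun ω => greenHat G W U (fun v => β v ω) i j) P := by
  by_cases hi : i ∈ U
  · obtain ⟨o, ho⟩ := Infinite.exists_notMem_finset U
    obtain ⟨σ⟩ := hG.preconnected o i
    exact allMoments_greenHat_of_walk hsymm hW hβ σ j (fun h => absurd h ho) hi
  · simp only [greenHat, hi, false_and, if_false]
    exact allMoments_const 0

theorem IsBetaField.allMoments_psi [Infinite V] (hG : G.Connected) (i : V) :
    AllMoments (fun ω => psi G W U (fun v => β v ω) i) P := by
  by_cases hi : i ∈ U
  · have h := AllMoments.sum U fun j _ =>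
      (hβ.allMoments_greenHat (U := U) hsymm hW hG i j).const_mul (boundaryWeight G W U j)
    refine h.congr ?_
    filter_upwards [(hβ.hasGreenLaplace hsymm hW U).isGreen] with ω h1
    rw [h1.psi_eq hsymm hW hi]
    exact Finset.sum_congr rfl fun j _ => mul_comm _ _
  · simp only [psi, hi, if_false]
    exact allMoments_const 1

end Moments

/-! ### Second order expansion of exponential functionals at ε = 0 -/

section Expansion

open Real

lemma abs_exp_neg_sub_le {x : ℝ} (hx : 0 ≤ x) :
    |exp (-x) - (1 - x + x ^ 2 / 2)| ≤ x ^ 3 := by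
  rcases le_or_gt x 1 with h1 | h1
  · have h := Real.exp_bound (x := -x) (by rwa [abs_neg, abs_of_nonneg hx]) (n := 3) (by norm_num)
    have h3 : 0 ≤ x ^ 3 := by positivity
    simp only [Finset.sum_range_succ, Finset.sum_range_zero, abs_neg, abs_of_nonneg hx] at h
    norm_num [Nat.factorial] at h
    rw [show exp (-x) - (1 - x + x ^ 2 / 2) = exp (-x) - (1 + -x + x ^ 2 / 2) by ring]
    linarith
  · have h2 : exp (-x) ≤ 1 := by simpa using hx
    have h3 := exp_pos (-x)
    rw [abs_le]
    constructor <;> nlinarith [mul_pos (sub_pos.2 h1) (sub_pos.2 h1), sq_nonneg x,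
      mul_nonneg hx (sub_pos.2 h1).le, mul_nonneg (sq_nonneg x) (sub_pos.2 h1).le]

/-- The remainder is ε³ times a polynomial in `S` and `Q`, hence integrable when all moments are
finite; ε ≤ 1 absorbs the ε⁴ term. -/
lemma abs_exp_neg_quadratic_sub_le {S Q ε : ℝ} (hS : 0 ≤ S) (hQ : 0 ≤ Q) (hε : 0 < ε)
    (hε1 : ε ≤ 1) :
    |exp (-(ε * S + 1 / 2 * ε ^ 2 * Q)) - (1 - ε * S + 1 / 2 * ε ^ 2 * (S * S - Q))|
      ≤ ε ^ 3 * (1 / 2 * (S * Q) + 1 / 8 * (Q * Q)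
        + (S + 1 / 2 * Q) * (S + 1 / 2 * Q) * (S + 1 / 2 * Q)) := by
  set x := ε * S + 1 / 2 * ε ^ 2 * Q with hx
  have hx0 : 0 ≤ x := by positivity
  have h1 := abs_le.1 (abs_exp_neg_sub_le hx0)
  have h2 : x ≤ ε * (S + 1 / 2 * Q) := by
    have : ε ^ 2 * Q ≤ ε * Q := mul_le_mul_of_nonneg_right (by nlinarith) hQ
    rw [hx]
    linarith
  have h3 : x ^ 3 ≤ ε ^ 3 * ((S + 1 / 2 * Q) * (S + 1 / 2 * Q) * (S + 1 / 2 * Q)) :=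
    (pow_le_pow_left₀ hx0 h2 3).trans_eq (by ring)
  have h4 : x ^ 2 / 2 = 1 / 2 * ε ^ 2 * (S * S) + 1 / 2 * ε ^ 3 * (S * Q)
      + 1 / 8 * (ε ^ 4 * (Q * Q)) := by rw [hx]; ring
  have h5 : ε ^ 4 * (Q * Q) ≤ ε ^ 3 * (Q * Q) :=
    mul_le_mul_of_nonneg_right (pow_le_pow_of_le_one hε.le hε1 (by norm_num)) (mul_nonneg hQ hQ)
  have h6 : 0 ≤ ε ^ 3 * (S * Q) := by positivity
  have h7 : 0 ≤ ε ^ 4 * (Q * Q) := by positivity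
  rw [abs_le]
  constructor <;> linarith [h1.1, h1.2]

/-- Divide by ε and let ε → 0 to get `a = 0`, then divide by ε². -/
lemma eq_zero_of_abs_le_cube {a b C : ℝ}
    (h : ∀ ε : ℝ, 0 < ε → ε ≤ 1 → |a * ε + b * ε ^ 2| ≤ C * ε ^ 3) : a = 0 ∧ b = 0 := by
  have hlim : ∀ c d : ℝ, (∀ ε : ℝ, 0 < ε → ε ≤ 1 → |c| ≤ d * ε) → c = 0 := by
    intro c d hcd
    have ht : Filter.Tendsto (fun ε : ℝ => d * ε) (nhdsWithin 0 (Set.Ioi 0)) (nhds (d * 0)) :=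
      ((continuous_const_mul d).tendsto 0).mono_left nhdsWithin_le_nhds
    rw [mul_zero] at ht
    have hle : |c| ≤ 0 := by
      refine ge_of_tendsto ht ?_
      filter_upwards [Ioc_mem_nhdsGT (zero_lt_one' ℝ)] with ε hε using hcd ε hε.1 hε.2
    exact abs_eq_zero.1 (le_antisymm hle (abs_nonneg c))
  have hC : 0 ≤ C := by
    have := (abs_nonneg _).trans (h 1 one_pos le_rfl)
    linarith
  have ha : a = 0 := by
    refine hlim a (C + |b|) fun ε hε hε1 => ?_
    have h1 := h ε hε hε1
    have h2 : |a| * ε ≤ C * ε ^ 3 + |b| * ε ^ 2 := by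
      have h3 := abs_sub (a * ε + b * ε ^ 2) (b * ε ^ 2)
      rw [show a * ε + b * ε ^ 2 - b * ε ^ 2 = a * ε by ring] at h3
      rw [abs_mul, abs_of_pos hε, abs_mul b, abs_of_pos (by positivity : 0 < ε ^ 2)] at h3
      linarith
    have h4 : C * ε ^ 3 ≤ C * ε ^ 2 :=
      mul_le_mul_of_nonneg_left (pow_le_pow_of_le_one hε.le hε1 (by norm_num)) hC
    exact le_of_mul_le_mul_right (a := ε) (by nlinarith) hε
  refine ⟨ha, hlim b C fun ε hε hε1 => ?_⟩
  have h1 := h ε hε hε1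
  rw [ha, zero_mul, zero_add, abs_mul, abs_of_pos (by positivity : 0 < ε ^ 2)] at h1
  exact le_of_mul_le_mul_right (a := ε ^ 2) (by linarith) (by positivity)

variable {Ω : Type*} [MeasurableSpace Ω] {P : Measure Ω}

/-- Expansion of the integral to second order at `0`. -/
lemma exists_abs_integral_exp_sub_le [IsFiniteMeasure P] {S Q : Ω → ℝ}
    (hS : AllMoments S P) (hQ : AllMoments Q P) (hS0 : ∀ᵐ ω ∂P, 0 ≤ S ω) (hQ0 : ∀ᵐ ω ∂P, 0 ≤ Q ω)
    (A : Set Ω) :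
    ∃ C : ℝ, ∀ ε : ℝ, 0 < ε → ε ≤ 1 →
      |∫ ω in A, exp (-(ε * S ω + 1 / 2 * ε ^ 2 * Q ω)) ∂P
        - (P.real A - ε * ∫ ω in A, S ω ∂P + 1 / 2 * ε ^ 2 * ∫ ω in A, (S ω * S ω - Q ω) ∂P)|
      ≤ C * ε ^ 3 := by
  have hSQ := hS.add (hQ.const_mul (1 / 2))
  have hK := ((hS.mul hQ).const_mul (1 / 2)).add ((hQ.mul hQ).const_mul (1 / 8)) |>.add
    ((hSQ.mul hSQ).mul hSQ)
  have hSi := hS.integrable.integrableOn (s := A)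
  have hDi : IntegrableOn (fun ω => S ω * S ω - Q ω) A P :=
    ((hS.mul hS).integrable.sub hQ.integrable).integrableOn
  refine ⟨∫ ω in A, (1 / 2 * (S ω * Q ω) + 1 / 8 * (Q ω * Q ω)
    + (S ω + 1 / 2 * Q ω) * (S ω + 1 / 2 * Q ω) * (S ω + 1 / 2 * Q ω)) ∂P, fun ε hε hε1 => ?_⟩
  have hE : IntegrableOn (fun ω => exp (-(ε * S ω + 1 / 2 * ε ^ 2 * Q ω))) A P := by
    have hm : AEStronglyMeasurable (fun ω => exp (-(ε * S ω + 1 / 2 * ε ^ 2 * Q ω))) P := by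
      have h1 := hS.integrable.aestronglyMeasurable
      have h2 := hQ.integrable.aestronglyMeasurable
      exact continuous_exp.comp_aestronglyMeasurable
        ((h1.const_mul ε).add (h2.const_mul (1 / 2 * ε ^ 2))).neg
    refine (Integrable.of_bound hm 1 ?_).integrableOn
    filter_upwards [hS0, hQ0] with ω h1 h2
    rw [norm_of_nonneg (exp_pos _).le, exp_le_one_iff, neg_nonpos]
    positivity
  have h1S : IntegrableOn (fun ω => 1 - ε * S ω) A P := (integrable_const 1).sub (hSi.const_mul ε)
  have hpi : IntegrableOn (fun ω => 1 - ε * S ω + 1 / 2 * ε ^ 2 * (S ω * S ω - Q ω)) A P :=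
    h1S.add (hDi.const_mul _)
  have hpoly : P.real A - ε * ∫ ω in A, S ω ∂P + 1 / 2 * ε ^ 2 * ∫ ω in A, (S ω * S ω - Q ω) ∂P
      = ∫ ω in A, (1 - ε * S ω + 1 / 2 * ε ^ 2 * (S ω * S ω - Q ω)) ∂P := by
    rw [integral_add h1S (hDi.const_mul _), integral_sub (integrable_const 1) (hSi.const_mul ε),
      integral_const_mul, integral_const_mul]
    simp
  rw [← norm_eq_abs, hpoly, ← integral_sub hE hpi, mul_comm _ (ε ^ 3), ← integral_const_mul]
  refine norm_integral_le_of_norm_le ((hK.integrable.integrableOn (s := A)).const_mul _) ?_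
  filter_upwards [ae_restrict_of_ae hS0, ae_restrict_of_ae hQ0] with ω h1 h2
  exact abs_exp_neg_quadratic_sub_le h1 h2 hε hε1

/-- Equal functions of ε have equal coefficients: -∫S at order ε, and ½∫(S² - Q) at order ε². The
second combination is the source of the bracket ψψ - Ĝ. -/
lemma moments_eq_of_integral_exp_eq [IsFiniteMeasure P] {S Q S' Q' : Ω → ℝ}
    (hS : AllMoments S P) (hQ : AllMoments Q P) (hS0 : ∀ᵐ ω ∂P, 0 ≤ S ω) (hQ0 : ∀ᵐ ω ∂P, 0 ≤ Q ω)
    (hS' : AllMoments S' P) (hQ' : AllMoments Q' P) (hS0' : ∀ᵐ ω ∂P, 0 ≤ S' ω)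
    (hQ0' : ∀ᵐ ω ∂P, 0 ≤ Q' ω) {A : Set Ω}
    (h : ∀ ε : ℝ, 0 < ε → ∫ ω in A, exp (-(ε * S ω + 1 / 2 * ε ^ 2 * Q ω)) ∂P
      = ∫ ω in A, exp (-(ε * S' ω + 1 / 2 * ε ^ 2 * Q' ω)) ∂P) :
    ∫ ω in A, S ω ∂P = ∫ ω in A, S' ω ∂P
      ∧ ∫ ω in A, (S ω * S ω - Q ω) ∂P = ∫ ω in A, (S' ω * S' ω - Q' ω) ∂P := by
  obtain ⟨C, hC⟩ := exists_abs_integral_exp_sub_le hS hQ hS0 hQ0 A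
  obtain ⟨C', hC'⟩ := exists_abs_integral_exp_sub_le hS' hQ' hS0' hQ0' A
  have key := eq_zero_of_abs_le_cube
    (a := ∫ ω in A, S ω ∂P - ∫ ω in A, S' ω ∂P)
    (b := 1 / 2 * (∫ ω in A, (S' ω * S' ω - Q' ω) ∂P - ∫ ω in A, (S ω * S ω - Q ω) ∂P))
    (C := C + C') fun ε hε hε1 => by
      have h1 := abs_le.1 (hC ε hε hε1)
      have h2 := abs_le.1 (hC' ε hε hε1)
      rw [← h ε hε] at h2
      rw [abs_le]
      constructor <;> linarith [h1.1, h1.2, h2.1, h2.2]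
  constructor <;> linarith [key.1, key.2]

end Expansion

/-! ### Exponential functionals of nested finite sets -/

section ExponentialForm

open Real

variable {V : Type*} {G : SimpleGraph V} {W : V → V → ℝ} {U : Finset V} {b : V → ℝ}

-- Outside `U` ψ is 1 and Ĝ is 0, so that part of λ contributes a deterministic summand.
open Classical in
lemma expoForm_eq (lam : V →₀ ℝ) :
    expoForm G W U b lam = greenForm G W U b lam + ∑ i ∈ lam.support with i ∉ U, lam i := by
  have h1 : ∑ i ∈ lam.support, lam i * psi G W U b i
      = ∑ i ∈ U, lam i * psi G W U b i + ∑ i ∈ lam.support with i ∉ U, lam i := by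
    rw [← Finset.sum_filter_add_sum_filter_not _ (· ∈ U)]
    congr 1
    · refine Finset.sum_congr_of_eq_on_inter ?_ ?_ fun _ _ _ => rfl
      · exact fun i hi hiU => absurd (Finset.mem_filter.1 hi).2 hiU
      · intro i hi hni
        have : lam i = 0 := by simpa [hi] using hni
        rw [this, zero_mul]
    · refine Finset.sum_congr rfl fun i hi => ?_
      rw [psi, if_neg (Finset.mem_filter.1 hi).2, mul_one]
  have hsub : ∀ g : V → ℝ, (∀ i, i ∉ U → g i = 0) → (∀ i, lam i = 0 → g i = 0) →
      ∑ i ∈ lam.support, g i = ∑ i ∈ U, g i := fun g hg1 hg2 =>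
    Finset.sum_congr_of_eq_on_inter (fun i _ hi => hg1 i hi)
      (fun i _ hi => hg2 i (Finsupp.notMem_support_iff.1 hi)) fun _ _ _ => rfl
  have h2 : ∑ i ∈ lam.support, ∑ j ∈ lam.support, lam i * greenHat G W U b i j * lam j
      = ∑ i ∈ U, ∑ j ∈ U, lam i * greenHat G W U b i j * lam j := by
    rw [hsub]
    · refine Finset.sum_congr rfl fun i _ => hsub _ (fun j hj => ?_) fun j hj => ?_
      · simp [greenHat, hj]
      · rw [hj, mul_zero]
    · exact fun i hi => Finset.sum_eq_zero fun j _ => by simp [greenHat, hi]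
    · exact fun i hi => Finset.sum_eq_zero fun j _ => by rw [hi]; ring
  rw [expoForm, h1, h2, greenForm]
  ring

lemma expoForm_smul {ε : ℝ} (hε : ε ≠ 0) (lam : V →₀ ℝ) :
    expoForm G W U b (ε • lam) = ε * (lam.sum fun i x => x * psi G W U b i)
      + 1 / 2 * ε ^ 2 * (lam.sum fun i x => lam.sum fun j y => x * greenHat G W U b i j * y) := by
  simp only [expoForm, Finsupp.support_smul_eq hε, Finsupp.sum, Finsupp.smul_apply, smul_eq_mul,
    Finset.mul_sum]
  congr 1
  · exact Finset.sum_congr rfl fun i _ => by ring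
  · exact Finset.sum_congr rfl fun i _ => Finset.sum_congr rfl fun j _ => by ring

variable {Ω : Type*} {m : MeasurableSpace Ω} {β : V → Ω → ℝ}

lemma measurable_expoForm [Countable V] (hβ : ∀ v ∈ U, Measurable (β v)) (lam : V →₀ ℝ) :
    Measurable fun ω => expoForm G W U (fun v => β v ω) lam := by
  simp only [expoForm_eq]
  exact (measurable_greenForm hβ lam).add_const _

variable {P : Measure Ω} [IsProbabilityMeasure P] [G.LocallyFinite]
  (hsymm : ∀ i j, W i j = W j i) (hW : ∀ i j, G.Adj i j → 0 < W i j) (hβ : IsBetaField G W P β)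

include hsymm hW hβ

/-- The point is that the right side does not involve `U`. As μ vanishes off `U'`, the two values of
`betaLaplace` are the same expectation, and each point of `lam.support` outside `U` contributes λ_i
· 1 = λ_i √(1 + 0). -/
lemma IsBetaField.lintegral_expoForm [Countable V] {U' : Finset V} (hUU' : U' ⊆ U) {mu : V → ℝ}
    (hmu : ∀ i, 0 ≤ mu i) (hmu0 : ∀ i, i ∉ U' → mu i = 0) {lam : V →₀ ℝ} (hlam : ∀ i, 0 ≤ lam i) :
    ∫⁻ ω, ENNReal.ofReal (exp (-expoForm G W U (fun v => β v ω) lam))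
        * ENNReal.ofReal (exp (-∑ i ∈ U', mu i * β i ω)) ∂P
      = ENNReal.ofReal (exp (-∑ i ∈ lam.support, lam i * √(1 + mu i))
          * betaLaplace G W U' mu) := by
  classical
  have hsum : ∀ ω, ∑ i ∈ U, mu i * β i ω = ∑ i ∈ U', mu i * β i ω := fun ω =>
    (Finset.sum_subset hUU' fun i _ hi => by rw [hmu0 i hi, zero_mul]).symm
  have hbeta : betaLaplace G W U mu = betaLaplace G W U' mu := by
    rw [← hβ.laplace U mu fun i _ => hmu i, ← hβ.laplace U' mu fun i _ => hmu i]
    simp only [hsum]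
  have h1 : ∀ ω, ENNReal.ofReal (exp (-expoForm G W U (fun v => β v ω) lam))
        * ENNReal.ofReal (exp (-∑ i ∈ U', mu i * β i ω))
      = ENNReal.ofReal (exp (-∑ i ∈ lam.support with i ∉ U, lam i))
        * ENNReal.ofReal (exp (-∑ i ∈ U, mu i * β i ω
          - greenForm G W U (fun v => β v ω) lam)) := fun ω => by
    rw [← ENNReal.ofReal_mul (exp_pos _).le, ← ENNReal.ofReal_mul (exp_pos _).le, ← exp_add,
      ← exp_add, expoForm_eq, hsum]
    congr 2
    ring
  have h2 : ∑ i ∈ lam.support, lam i * √(1 + mu i)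
      = ∑ i ∈ U, lam i * √(1 + mu i) + ∑ i ∈ lam.support with i ∉ U, lam i := by
    rw [← Finset.sum_filter_add_sum_filter_not _ (· ∈ U)]
    congr 1
    · refine Finset.sum_congr_of_eq_on_inter ?_ ?_ fun _ _ _ => rfl
      · exact fun i hi hiU => absurd (Finset.mem_filter.1 hi).2 hiU
      · intro i hi hni
        have : lam i = 0 := by simpa [hi] using hni
        rw [this, zero_mul]
    · refine Finset.sum_congr rfl fun i hi => ?_
      rw [hmu0 i fun h => (Finset.mem_filter.1 hi).2 (hUU' h)]
      simp
  simp only [h1]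
  rw [lintegral_const_mul' _ _ ENNReal.ofReal_ne_top,
    (hβ.hasGreenLaplace hsymm hW U).laplace mu lam hmu hlam, ← ENNReal.ofReal_mul (exp_pos _).le,
    ← mul_assoc, ← exp_add, hbeta, h2]
  congr 3
  ring

lemma IsBetaField.integrable_exp_expoForm [Countable V] {lam : V →₀ ℝ} (hlam : ∀ i, 0 ≤ lam i) :
    Integrable (fun ω => exp (-expoForm G W U (fun v => β v ω) lam)) P := by
  have hm := measurable_expoForm (G := G) (W := W) (U := U) (fun v _ => hβ.measurable v) lam
  refine (lintegral_ofReal_ne_top_iff_integrable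
    (by exact (measurable_exp.comp hm.neg).aestronglyMeasurable) (ae_of_all _ fun ω => (exp_pos _).le)).1 ?_
  have h := hβ.lintegral_expoForm hsymm hW (Finset.empty_subset U) (mu := fun _ => 0)
    (fun _ => le_rfl) (fun _ _ => rfl) hlam
  simp only [Finset.sum_empty, neg_zero, exp_zero, ENNReal.ofReal_one, mul_one] at h
  rw [h]
  exact ENNReal.ofReal_ne_top

omit [IsProbabilityMeasure P] [G.LocallyFinite] hsymm hW hβ in
lemma exists_preimage_restrict {A : Set Ω}
    (hA : MeasurableSet[⨆ i ∈ U, MeasurableSpace.comap (β i) inferInstance] A) :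
    ∃ B : Set (U → ℝ), MeasurableSet B ∧ (fun ω (i : U) => β i ω) ⁻¹' B = A := by
  have hle : (⨆ i ∈ U, MeasurableSpace.comap (β i) inferInstance)
      ≤ MeasurableSpace.comap (fun ω (i : U) => β i ω) inferInstance := by
    refine iSup₂_le fun i hi => ?_
    rintro _ ⟨s, hs, rfl⟩
    exact ⟨(fun x : U → ℝ => x ⟨i, hi⟩) ⁻¹' s, measurable_pi_apply _ hs, rfl⟩
  exact hle A hA

/-- The exponential functionals of `U'` and of a larger set `U` have the same integral on the events
that depend only on the potential in `U'`. -/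
lemma IsBetaField.setIntegral_expoForm_eq [Countable V] {U' : Finset V} (hUU' : U' ⊆ U)
    {lam : V →₀ ℝ} (hlam : ∀ i, 0 ≤ lam i) {A : Set Ω}
    (hA : MeasurableSet[⨆ i ∈ U', MeasurableSpace.comap (β i) inferInstance] A) :
    ∫ ω in A, exp (-expoForm G W U (fun v => β v ω) lam) ∂P
      = ∫ ω in A, exp (-expoForm G W U' (fun v => β v ω) lam) ∂P := by
  classical
  have hm : ∀ T : Finset V, Measurable fun ω =>
      ENNReal.ofReal (exp (-expoForm G W T (fun v => β v ω) lam)) := fun T => by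
    have := measurable_expoForm (G := G) (W := W) (U := T) (fun v _ => hβ.measurable v) lam
    fun_prop
  -- Weighting P by the exponential functional of `T` reduces the claim to the law of β on `U'`: its
  -- Laplace transform under `Q T` is the same for all `T ⊇ U'`.
  set Q : Finset V → Measure Ω := fun T =>
    P.withDensity fun ω => ENNReal.ofReal (exp (-expoForm G W T (fun v => β v ω) lam)) with hQ
  have hfin : ∀ T, IsFiniteMeasure (Q T) := fun T =>
    isFiniteMeasure_withDensity_ofReal (hβ.integrable_exp_expoForm hsymm hW hlam).2
  have hpos : ∀ T, ∀ i ∈ U', ∀ᵐ ω ∂(Q T), 0 ≤ β i ω := fun T i _ =>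
    (withDensity_absolutelyContinuous _ _).ae_le ((hβ.pos i).mono fun ω h => h.le)
  have hlap : ∀ T, U' ⊆ T → ∀ mu : V → ℝ, (∀ i, 0 ≤ mu i) →
      ∫⁻ ω, ENNReal.ofReal (exp (-∑ i ∈ U', mu i * β i ω)) ∂(Q T)
        = ENNReal.ofReal (exp (-∑ i ∈ lam.support, lam i * √(1 + if i ∈ U' then mu i else 0))
          * betaLaplace G W U' fun i => if i ∈ U' then mu i else 0) := by
    intro T hT mu hmu
    have hbm := hβ.measurable
    -- μ is truncated to `U'`, which leaves the sum over `U'` unchanged and meets the support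
    -- condition.
    rw [← hβ.lintegral_expoForm hsymm hW hT (mu := fun i => if i ∈ U' then mu i else 0)
      (fun i => by split_ifs; exacts [hmu i, le_rfl]) (fun i hi => if_neg hi) hlam, hQ,
      lintegral_withDensity_eq_lintegral_mul _ (hm T) (by fun_prop)]
    refine lintegral_congr fun ω => ?_
    rw [Pi.mul_apply]
    congr 4
    exact Finset.sum_congr rfl fun i hi => by rw [if_pos hi]
  have hmap := map_eq_of_laplace hβ.measurable hβ.measurable (hpos U) (hpos U') fun mu hmu => by
    rw [hlap U hUU' mu hmu, hlap U' subset_rfl mu hmu]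
  obtain ⟨B, hB, rfl⟩ := exists_preimage_restrict hA
  have hr : Measurable fun ω (i : U') => β i ω :=
    measurable_pi_lambda _ fun i => hβ.measurable i
  have hAB := congrArg (fun ν => ν B) hmap
  rw [Measure.map_apply hr hB, Measure.map_apply hr hB, hQ, withDensity_apply _ (hr hB),
    withDensity_apply _ (hr hB)] at hAB
  have hm' : ∀ T : Finset V, AEStronglyMeasurable
      (fun ω => exp (-expoForm G W T (fun v => β v ω) lam))
      (P.restrict ((fun ω (i : U') => β i ω) ⁻¹' B)) := fun T =>
    (measurable_exp.comp (measurable_expoForm (fun v _ => hβ.measurable v)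
      lam).neg).aestronglyMeasurable
  rw [integral_eq_lintegral_of_nonneg_ae (ae_of_all _ fun ω => (exp_pos _).le) (hm' U),
    integral_eq_lintegral_of_nonneg_ae (ae_of_all _ fun ω => (exp_pos _).le) (hm' U'), hAB]

end ExponentialForm

/-! ### The three martingale statements -/

section Martingales

variable {V : Type*} [Countable V] [Infinite V] {G : SimpleGraph V} {W : V → V → ℝ}
  {U : Finset V} [G.LocallyFinite] {Ω : Type*} [MeasurableSpace Ω] {P : Measure Ω}
  [IsProbabilityMeasure P] {β : V → Ω → ℝ} (hG : G.Connected)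
  (hsymm : ∀ i j, W i j = W j i) (hW : ∀ i j, G.Adj i j → 0 < W i j) (hβ : IsBetaField G W P β)

omit [Infinite V] in
include hsymm hW hβ in
lemma IsBetaField.ae_psi_nonneg (i : V) : ∀ᵐ ω ∂P, 0 ≤ psi G W U (fun v => β v ω) i := by
  filter_upwards [(hβ.hasGreenLaplace hsymm hW U).isGreen] with ω h
  by_cases hi : i ∈ U
  · rw [h.psi_eq hsymm hW hi]
    exact Finset.sum_nonneg fun j _ => mul_nonneg (h.nonneg i j) (boundaryWeight_nonneg hW j)
  · simp [psi, hi]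

include hG hsymm hW hβ

/-- The exponential functionals at ελ have equal integrals over `A` for every ε > 0; the two
equalities are the coefficients of ε and ε². -/
lemma IsBetaField.setIntegral_sum_eq {U' : Finset V} (hUU' : U' ⊆ U)
    {lam : V →₀ ℝ} (hlam : ∀ i, 0 ≤ lam i) {A : Set Ω}
    (hA : MeasurableSet[⨆ i ∈ U', MeasurableSpace.comap (β i) inferInstance] A) :
    (∫ ω in A, (lam.sum fun i x => x * psi G W U (fun v => β v ω) i) ∂P
        = ∫ ω in A, (lam.sum fun i x => x * psi G W U' (fun v => β v ω) i) ∂P)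
      ∧ ∫ ω in A, ((lam.sum fun i x => x * psi G W U (fun v => β v ω) i)
            * (lam.sum fun i x => x * psi G W U (fun v => β v ω) i)
            - lam.sum fun i x => lam.sum fun j y =>
              x * greenHat G W U (fun v => β v ω) i j * y) ∂P
        = ∫ ω in A, ((lam.sum fun i x => x * psi G W U' (fun v => β v ω) i)
            * (lam.sum fun i x => x * psi G W U' (fun v => β v ω) i)
            - lam.sum fun i x => lam.sum fun j y =>
              x * greenHat G W U' (fun v => β v ω) i j * y) ∂P := by
  have hS : ∀ T : Finset V,
      AllMoments (fun ω => lam.sum fun i x => x * psi G W T (fun v => β v ω) i) P := fun T =>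
    AllMoments.sum _ fun i _ => (hβ.allMoments_psi hsymm hW hG i).const_mul _
  have hQ : ∀ T : Finset V, AllMoments (fun ω => lam.sum fun i x => lam.sum fun j y =>
      x * greenHat G W T (fun v => β v ω) i j * y) P := fun T =>
    AllMoments.sum _ fun i _ => AllMoments.sum _ fun j _ =>
      ((hβ.allMoments_greenHat hsymm hW hG i j).const_mul _).mul (allMoments_const _)
  have hS0 : ∀ T : Finset V,
      ∀ᵐ ω ∂P, 0 ≤ lam.sum fun i x => x * psi G W T (fun v => β v ω) i := fun T => by
    filter_upwards [ae_all_iff.2 fun i => hβ.ae_psi_nonneg (U := T) hsymm hW i] with ω h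
    exact Finset.sum_nonneg fun i _ => mul_nonneg (hlam i) (h i)
  have hQ0 : ∀ T : Finset V, ∀ᵐ ω ∂P, 0 ≤ lam.sum fun i x => lam.sum fun j y =>
      x * greenHat G W T (fun v => β v ω) i j * y := fun T => by
    filter_upwards [(hβ.hasGreenLaplace hsymm hW T).isGreen] with ω h
    exact Finset.sum_nonneg fun i _ => Finset.sum_nonneg fun j _ =>
      mul_nonneg (mul_nonneg (hlam i) (h.nonneg i j)) (hlam j)
  refine moments_eq_of_integral_exp_eq (hS U) (hQ U) (hS0 U) (hQ0 U) (hS U') (hQ U') (hS0 U')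
    (hQ0 U') fun ε hε => ?_
  have h := hβ.setIntegral_expoForm_eq hsymm hW hUU' (lam := ε • lam)
    (fun i => mul_nonneg hε.le (hlam i)) hA
  simpa only [expoForm_smul hε.ne'] using h

lemma IsBetaField.setIntegral_psi_eq {U' : Finset V} (hUU' : U' ⊆ U) {A : Set Ω}
    (hA : MeasurableSet[⨆ i ∈ U', MeasurableSpace.comap (β i) inferInstance] A) (i : V) :
    ∫ ω in A, psi G W U (fun v => β v ω) i ∂P = ∫ ω in A, psi G W U' (fun v => β v ω) i ∂P := by
  have h := (hβ.setIntegral_sum_eq hG hsymm hW hUU' (lam := Finsupp.single i 1)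
    (fun j => by classical rw [Finsupp.single_apply]; split_ifs <;> norm_num) hA).1
  simpa using h

/-- Polarization: λ must be nonnegative, so the diagonal identity is used at e_i + e_j, e_i and e_j,
with the symmetry of Ĝ. -/
lemma IsBetaField.setIntegral_psi_mul_sub_greenHat_eq {U' : Finset V} (hUU' : U' ⊆ U) {A : Set Ω}
    (hA : MeasurableSet[⨆ i ∈ U', MeasurableSpace.comap (β i) inferInstance] A) (i j : V) :
    ∫ ω in A, (psi G W U (fun v => β v ω) i * psi G W U (fun v => β v ω) j
        - greenHat G W U (fun v => β v ω) i j) ∂P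
      = ∫ ω in A, (psi G W U' (fun v => β v ω) i * psi G W U' (fun v => β v ω) j
        - greenHat G W U' (fun v => β v ω) i j) ∂P := by
  classical
  have hsingle : ∀ k l : V, 0 ≤ (Finsupp.single k (1 : ℝ)) l := fun k l => by
    rw [Finsupp.single_apply]
    split_ifs <;> norm_num
  have hp : ∀ (f : V → ℝ), ((Finsupp.single i (1 : ℝ) + Finsupp.single j 1).sum fun k x => x * f k)
      = f i + f j := fun f => by
    rw [Finsupp.sum_add_index' (by simp) (by intros; ring)]
    simp
  have hq : ∀ (g : V → V → ℝ), ((Finsupp.single i (1 : ℝ) + Finsupp.single j 1).sum fun k x =>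
      (Finsupp.single i (1 : ℝ) + Finsupp.single j 1).sum fun l y => x * g k l * y)
      = g i i + g i j + (g j i + g j j) := fun g => by
    have h1 : ∀ k (x : ℝ), ((Finsupp.single i (1 : ℝ) + Finsupp.single j 1).sum
        fun l y => x * g k l * y) = x * (g k i + g k j) := fun k x => by
      rw [Finsupp.sum_add_index' (by simp) (by intros; ring)]
      simp
      ring
    simp only [h1]
    exact hp fun k => g k i + g k j
  have hij := (hβ.setIntegral_sum_eq hG hsymm hW hUU'
    (lam := Finsupp.single i 1 + Finsupp.single j 1)
    (fun k => add_nonneg (hsingle i k) (hsingle j k)) hA).2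
  have hi := (hβ.setIntegral_sum_eq hG hsymm hW hUU' (hsingle i) hA).2
  have hj := (hβ.setIntegral_sum_eq hG hsymm hW hUU' (hsingle j) hA).2
  simp only [hp, hq] at hij
  simp only [Finsupp.sum_single_index, one_mul, mul_one, mul_zero, zero_mul] at hi hj
  have hD : ∀ (T : Finset V) (k l : V), IntegrableOn (fun ω =>
      psi G W T (fun v => β v ω) k * psi G W T (fun v => β v ω) l
        - greenHat G W T (fun v => β v ω) k l) A P := fun T k l =>
    (((hβ.allMoments_psi hsymm hW hG k).mul (hβ.allMoments_psi hsymm hW hG l)).integrable.sub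
      (hβ.allMoments_greenHat hsymm hW hG k l).integrable).integrableOn
  have hpol : ∀ T : Finset V,
      ∫ ω in A, (psi G W T (fun v => β v ω) i * psi G W T (fun v => β v ω) j
          - greenHat G W T (fun v => β v ω) i j) ∂P
        = 1 / 2 * (∫ ω in A, ((psi G W T (fun v => β v ω) i + psi G W T (fun v => β v ω) j)
              * (psi G W T (fun v => β v ω) i + psi G W T (fun v => β v ω) j)
            - (greenHat G W T (fun v => β v ω) i i + greenHat G W T (fun v => β v ω) i j
              + (greenHat G W T (fun v => β v ω) j i + greenHat G W T (fun v => β v ω) j j))) ∂P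
          - ∫ ω in A, (psi G W T (fun v => β v ω) i * psi G W T (fun v => β v ω) i
              - greenHat G W T (fun v => β v ω) i i) ∂P
          - ∫ ω in A, (psi G W T (fun v => β v ω) j * psi G W T (fun v => β v ω) j
              - greenHat G W T (fun v => β v ω) j j) ∂P) := by
    intro T
    have hsum : ∫ ω in A, ((psi G W T (fun v => β v ω) i + psi G W T (fun v => β v ω) j)
              * (psi G W T (fun v => β v ω) i + psi G W T (fun v => β v ω) j)
            - (greenHat G W T (fun v => β v ω) i i + greenHat G W T (fun v => β v ω) i j
              + (greenHat G W T (fun v => β v ω) j i + greenHat G W T (fun v => β v ω) j j))) ∂P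
        = ∫ ω in A, (2 * (psi G W T (fun v => β v ω) i * psi G W T (fun v => β v ω) j
              - greenHat G W T (fun v => β v ω) i j)
            + (psi G W T (fun v => β v ω) i * psi G W T (fun v => β v ω) i
              - greenHat G W T (fun v => β v ω) i i)
            + (psi G W T (fun v => β v ω) j * psi G W T (fun v => β v ω) j
              - greenHat G W T (fun v => β v ω) j j)) ∂P := by
      refine integral_congr_ae (ae_restrict_of_ae ?_)
      filter_upwards [(hβ.hasGreenLaplace hsymm hW T).isGreen] with ω h
      rw [h.symm j i]
      ring
    have h1 : IntegrableOn (fun ω => 2 * (psi G W T (fun v => β v ω) i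
        * psi G W T (fun v => β v ω) j - greenHat G W T (fun v => β v ω) i j)) A P :=
      (hD T i j).const_mul 2
    have h2 : IntegrableOn (fun ω => 2 * (psi G W T (fun v => β v ω) i
        * psi G W T (fun v => β v ω) j - greenHat G W T (fun v => β v ω) i j)
        + (psi G W T (fun v => β v ω) i * psi G W T (fun v => β v ω) i
          - greenHat G W T (fun v => β v ω) i i)) A P := h1.add (hD T i i)
    rw [hsum, integral_add h2 (hD T j j), integral_add h1 (hD T i i),
      integral_const_mul]
    ring
  rw [hpol U, hpol U', hij, hi, hj]

omit [Countable V] [Infinite V] [G.LocallyFinite] hG hsymm hW hβ in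
lemma martingale_of_setIntegral_eq {F : Filtration ℕ ‹MeasurableSpace Ω›} {f : ℕ → Ω → ℝ}
    (hadp : ∀ n, Measurable[F n] (f n)) (hint : ∀ n, Integrable (f n) P)
    (h : ∀ n, ∀ A, MeasurableSet[F n] A → ∫ ω in A, f (n + 1) ω ∂P = ∫ ω in A, f n ω ∂P) :
    Martingale f F P :=
  martingale_nat (fun n => (hadp n).stronglyMeasurable) hint fun n =>
    ae_eq_condExp_of_forall_setIntegral_eq (F.le n) (hint (n + 1))
      (fun _ _ _ => (hint n).integrableOn) (fun A hA _ => (h n A hA).symm)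
      (hadp n).stronglyMeasurable.aestronglyMeasurable

omit [Countable V] [Infinite V] [G.LocallyFinite] [IsProbabilityMeasure P] hG hsymm hW hβ in
lemma measurable_betaFiltration (hm : ∀ i, Measurable (β i)) {Vn : ℕ → Finset V}
    (hmono : Monotone Vn) (n : ℕ) : ∀ v ∈ Vn n, Measurable[betaFiltration β hm Vn hmono n] (β v) :=
  fun v hv => measurable_iff_comap_le.2
    (le_iSup₂ (f := fun i (_ : i ∈ Vn n) => MeasurableSpace.comap (β i) inferInstance) v hv)

variable {Vn : ℕ → Finset V} (hmono : Monotone Vn)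

theorem IsBetaField.martingale_psi (i : V) :
    Martingale (fun n ω => psi G W (Vn n) (fun v => β v ω) i)
      (betaFiltration β hβ.measurable Vn hmono) P :=
  martingale_of_setIntegral_eq
    (fun n => measurable_psi (measurable_betaFiltration hβ.measurable hmono n) i)
    (fun _ => (hβ.allMoments_psi hsymm hW hG i).integrable)
    fun n _ hA => hβ.setIntegral_psi_eq hG hsymm hW (hmono n.le_succ) hA i

theorem IsBetaField.martingale_psi_mul_sub_greenHat (i j : V) :
    Martingale (fun n ω => psi G W (Vn n) (fun v => β v ω) i * psi G W (Vn n) (fun v => β v ω) j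
        - greenHat G W (Vn n) (fun v => β v ω) i j)
      (betaFiltration β hβ.measurable Vn hmono) P :=
  martingale_of_setIntegral_eq
    (fun n => by
      have h := measurable_betaFiltration hβ.measurable hmono n
      exact ((measurable_psi h i).mul (measurable_psi h j)).sub (measurable_greenHat h i j))
    (fun n => ((hβ.allMoments_psi hsymm hW hG i).mul
      (hβ.allMoments_psi hsymm hW hG j)).integrable.sub
      (hβ.allMoments_greenHat hsymm hW hG i j).integrable)
    fun n _ hA => hβ.setIntegral_psi_mul_sub_greenHat_eq hG hsymm hW (hmono n.le_succ) hA i j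

theorem IsBetaField.condExp_psi_mul_sub (n : ℕ) (i j : V) :
    P[fun ω => psi G W (Vn (n + 1)) (fun v => β v ω) i * psi G W (Vn (n + 1)) (fun v => β v ω) j
        - psi G W (Vn n) (fun v => β v ω) i * psi G W (Vn n) (fun v => β v ω) j |
        betaFiltration β hβ.measurable Vn hmono n]
      =ᵐ[P] P[fun ω => greenHat G W (Vn (n + 1)) (fun v => β v ω) i j
        - greenHat G W (Vn n) (fun v => β v ω) i j | betaFiltration β hβ.measurable Vn hmono n] := by
  set F := betaFiltration β hβ.measurable Vn hmono
  have hM := hβ.martingale_psi_mul_sub_greenHat hG hsymm hW hmono i j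
  have hψ : ∀ T : Finset V, Integrable (fun ω =>
      psi G W T (fun v => β v ω) i * psi G W T (fun v => β v ω) j) P := fun T =>
    ((hβ.allMoments_psi hsymm hW hG i).mul (hβ.allMoments_psi hsymm hW hG j)).integrable
  have hg : ∀ T : Finset V, Integrable (fun ω => greenHat G W T (fun v => β v ω) i j) P :=
    fun T => (hβ.allMoments_greenHat hsymm hW hG i j).integrable
  have h1 := condExp_sub ((hψ (Vn (n + 1))).sub (hψ (Vn n)))
    ((hg (Vn (n + 1))).sub (hg (Vn n))) (F n)
  have h2 := condExp_sub (hM.integrable (n + 1)) (hM.integrable n) (F n)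
  have h3 := hM.condExp_ae_eq n.le_succ
  have h4 := hM.condExp_ae_eq (le_refl n)
  -- The increment of ψψ minus that of Ĝ is the increment of the martingale ψψ - Ĝ, whose
  -- conditional expectation vanishes.
  have h5 : ∀ f g f' g' : Ω → ℝ, f - f' - (g - g') = (fun ω => f ω - g ω) - fun ω => f' ω - g' ω :=
    fun f g f' g' => by
      ext ω
      simp only [Pi.sub_apply]
      ring
  filter_upwards [h1, h2, h3, h4] with ω e1 e2 e3 e4
  have e5 := congrArg (fun f => P[f | F n] ω) (h5
    (fun ω => psi G W (Vn (n + 1)) (fun v => β v ω) i * psi G W (Vn (n + 1)) (fun v => β v ω) j)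
    (fun ω => greenHat G W (Vn (n + 1)) (fun v => β v ω) i j)
    (fun ω => psi G W (Vn n) (fun v => β v ω) i * psi G W (Vn n) (fun v => β v ω) j)
    (fun ω => greenHat G W (Vn n) (fun v => β v ω) i j))
  rw [e1] at e5
  have e6 := e5.trans e2
  simp only [Pi.sub_apply] at e6
  have e7 := e6.trans (congrArg₂ (· - ·) e3 e4)
  rw [sub_self] at e7
  exact sub_eq_zero.1 e7

omit [Infinite V] hG in
theorem IsBetaField.martingale_exp_expoForm {lam : V →₀ ℝ} (hlam : ∀ i, 0 ≤ lam i) :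
    Martingale (fun n ω => Real.exp (-expoForm G W (Vn n) (fun v => β v ω) lam))
      (betaFiltration β hβ.measurable Vn hmono) P :=
  martingale_of_setIntegral_eq
    (fun n => Real.measurable_exp.comp
      (measurable_expoForm (measurable_betaFiltration hβ.measurable hmono n) lam).neg)
    (fun _ => hβ.integrable_exp_expoForm hsymm hW hlam)
    fun n _ hA => hβ.setIntegral_expoForm_eq hsymm hW (hmono n.le_succ) hlam hA

end Martingales

end VRJP

end

theorem mainTheorem8
    {V : Type*} [Infinite V] (G : SimpleGraph V) [G.LocallyFinite] (hG : G.Connected)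
    (W : V → V → ℝ) (hWsymm : ∀ i j, W i j = W j i) (hWpos : ∀ i j, G.Adj i j → 0 < W i j)
    {Ω : Type*} [MeasurableSpace Ω] (P : Measure Ω) [IsProbabilityMeasure P]
    (β : V → Ω → ℝ) (hβ : VRJP.IsBetaField G W P β)
    (Vn : ℕ → Finset V) (hmono : Monotone Vn) (hexh : ∀ v, ∃ n, v ∈ Vn n) :
    let F : Filtration ℕ _ := VRJP.betaFiltration β hβ.measurable Vn hmono
    let ψ : ℕ → V → Ω → ℝ := fun n i ω => VRJP.psi G W (Vn n) (fun v => β v ω) i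
    let Ghat : ℕ → V → V → Ω → ℝ :=
      fun n i j ω => VRJP.greenHat G W (Vn n) (fun v => β v ω) i j
    -- the path sums defining `ψ` and `Ghat` converge almost surely
    (∀ n, ∀ i ∈ Vn n, ∀ᵐ ω ∂P, Summable (VRJP.psiTerm G W (Vn n) (fun v => β v ω) i)) ∧
    (∀ n, ∀ i ∈ Vn n, ∀ j ∈ Vn n, ∀ᵐ ω ∂P,
      Summable (VRJP.greenTerm G W (Vn n) (fun v => β v ω) i j)) ∧
    -- `ψ` has finite moments and is a martingale
    (∀ n i, ∀ p : ℝ≥0∞, p ≠ ∞ → MemLp (ψ n i) p P) ∧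
    (∀ i, Martingale (fun n => ψ n i) F P) ∧
    -- the bracket identity, between conditional expectations of integrable variables
    (∀ n i j, Integrable (Ghat n i j) P) ∧
    (∀ n i j,
      P[fun ω => ψ (n + 1) i ω * ψ (n + 1) j ω - ψ n i ω * ψ n j ω | F n]
        =ᵐ[P] P[fun ω => Ghat (n + 1) i j ω - Ghat n i j ω | F n]) ∧
    -- the exponential martingale
    (∀ lam : V →₀ ℝ, (∀ i, 0 ≤ lam i) →
      Martingale
        (fun n ω => Real.exp (-VRJP.expoForm G W (Vn n) (fun v => β v ω) lam)) F P) := by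
  -- The exhaustion by finite sets makes V countable, hence also the sets of walks, so the path sums
  -- are measurable in ω.
  have : Countable V := by
    have hU : (⋃ n, (Vn n : Set V)) = Set.univ :=
      Set.eq_univ_of_forall fun v => Set.mem_iUnion.2 (hexh v)
    exact Set.countable_univ_iff.1 (hU ▸ Set.countable_iUnion fun n => (Vn n).countable_toSet)
  intro F ψ Ghat
  refine ⟨fun n i hi => ?_, fun n i _ j _ => ?_, fun n i p hp => ?_,
    hβ.martingale_psi hG hWsymm hWpos hmono,
    fun n i j => (hβ.allMoments_greenHat hWsymm hWpos hG i j).integrable,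
    hβ.condExp_psi_mul_sub hG hWsymm hWpos hmono,
    fun lam hlam => hβ.martingale_exp_expoForm hWsymm hWpos hmono hlam⟩
  · filter_upwards [(hβ.hasGreenLaplace hWsymm hWpos (Vn n)).isGreen] with ω h
    exact h.summable_psiTerm hWsymm hWpos hi
  · filter_upwards [(hβ.hasGreenLaplace hWsymm hWpos (Vn n)).isGreen] with ω h
    exact h.summable_greenTerm hWsymm hWpos i j
  · lift p to NNReal using hp
    exact hβ.allMoments_psi hWsymm hWpos hG i p
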